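/- **Setting.** Let $\mathbb{F}_v$ be a finite field with $q_v$ elements, $A_v=\mathbb{F}_v[\![z]\!]$ and $Q_v=\mathbb{F}_v(\!(z)\!)$. Let $R$ be a complete discrete valuation ring with finite residue field and let $\gamma\colon A_v\hookrightarrow R$ be an injective ring homomorphism such that $\zeta:=\gamma(z)$ lies in the maximal ideal of $R$. View $R$ as an $\mathbb{F}_v$-algebra via $\gamma$; then $A_v\subset R[\![z]\!]$ and $Q_v\subset R[\![z]\!][\frac1z]$ by acting on coefficients. Let $\hat\sigma$ be the endomorphism of $R[\![z]\!]$ with $\hat\sigma(z)=z$ and $\hat\sigma(b)=b^{q_v}$ for $b\in R$; it extends to $R[\![z]\!][\frac1z]$. For an $R[\![z]\!]$-module $M$ put $\hat\sigma^*M:=M\otimes_{R[\![z]\!],\hat\sigma}R[\![z]\!]$. A *local shtuka* over $R$ is a pair $\underline{\hat M}=(\hat M,\tau_{\hat M})$ consisting of a free $R[\![z]\!]$-module $\hat M$ of finite rank and an isomorphism $\tau_{\hat M}\colon\hat\sigma^*\hat M[\frac1{z-\zeta}]\to\hat M[\frac1{z-\zeta}]$ of $R[\![z]\!][\frac1{z-\zeta}]$-modules;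 its rank is the rank of $\hat M$. A *morphism* $(\hat M,\tau_{\hat M})\to(\hat N,\tau_{\hat N})$ is a homomorphism $f\colon\hat M\to\hat N$ of $R[\![z]\!]$-modules with $\tau_{\hat N}\circ\hat\sigma^*f=f\circ\tau_{\hat M}$. A *quasi-morphism* is a homomorphism $f\colon\hat M[\frac1z]\to\hat N[\frac1z]$ of $R[\![z]\!][\frac1z]$-modules with $\tau_{\hat N}\circ\hat\sigma^*f=f\circ\tau_{\hat M}$ (after inverting both $z$ and $z-\zeta$); it is a *quasi-isogeny* if it is an isomorphism. Let $\mathrm{End}_R(\underline{\hat M})$ be the $A_v$-algebra of endomorphisms and $\mathrm{QEnd}_R(\underline{\hat M})$ the $Q_v$-algebra of quasi-morphisms from $\underline{\hat M}$ to itself; $\mathrm{End}_R(\underline{\hat M})\subset\mathrm{QEnd}_R(\underline{\hat M})$ via $h\mapsto h[\frac1z]$. **Proposition 3.2.** Let $\underline{\hat M}$ be a local shtuka over $R$ with complex multiplication by $E_v$; that is, $E_v$ is a commutative semi-simple $Q_v$-algebra (a finite product of finite, not necessarily separable, field extensions of $Q_v$) with $\dim_{Q_v}E_v=\operatorname{rk}\underline{\hat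 M}$, together with an injective homomorphism of $Q_v$-algebras $\iota\colon E_v\hookrightarrow\mathrm{QEnd}_R(\underline{\hat M})$. Let $\mathcal{O}_{E_v}$ be the integral closure of $A_v$ in $E_v$. Then there are a local shtuka $\underline{\hat M}'$ over $R$ and a quasi-isogeny $f\colon\underline{\hat M}\to\underline{\hat M}'$ such that $\mathcal{O}_{E_v}\subset\mathrm{End}_R(\underline{\hat M}')$ under the induced embedding $E_v\hookrightarrow\mathrm{QEnd}_R(\underline{\hat M}')$, $a\mapsto f\,\iota(a)\,f^{-1}$. That is, there is an injective homomorphism of $A_v$-algebras $j\colon\mathcal{O}_{E_v}\hookrightarrow\mathrm{End}_R(\underline{\hat M}')$ with $j(a)[\frac1z]\circ f=f\circ\iota(a)$ for all $a\in\mathcal{O}_{E_v}$. -/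

import Mathlib

universe u v w

open scoped PowerSeries LaurentSeries TensorProduct

noncomputable section

namespace LocSht

/-! ### Pullback of a module along a ring endomorphism -/

section Pullback

variable {S : Type*} [CommRing S] (σ : S →+* S)

/-- The ring `S`, regarded as an `S`-algebra by means of the endomorphism `σ`. -/
def Twist (_σ : S →+* S) : Type _ := S

instance : CommRing (Twist σ) := inferInstanceAs (CommRing S)

instance : Algebra S (Twist σ) := RingHom.toAlgebra (S := Twist σ) σ

/-- The identity, from `S` to its twisted copy. -/
def toTwist : S ≃+* Twist σ := RingEquiv.refl S

lemma algebraMap_twist (s : S) : algebraMap S (Twist σ) s = toTwist σ (σ s) := rfl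

/-- The pullback `σ^* M = S ⊗_{σ, S} M`. -/
def Pullback (M : Type*) [AddCommGroup M] [Module S M] : Type _ := Twist σ ⊗[S] M

variable {M N Q : Type*} [AddCommGroup M] [Module S M] [AddCommGroup N] [Module S N]
  [AddCommGroup Q] [Module S Q]

instance : AddCommGroup (Pullback σ M) := inferInstanceAs (AddCommGroup (Twist σ ⊗[S] M))

instance : Module (Twist σ) (Pullback σ M) := inferInstanceAs (Module (Twist σ) (Twist σ ⊗[S] M))

/-- `S` acts on `σ^* M = S ⊗_{σ, S} M` through the left factor (with its untwisted action). -/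
instance : Module S (Pullback σ M) := Module.compHom _ (toTwist σ : S →+* Twist σ)

/-- The `σ`-semilinear map `M → σ^* M`, `m ↦ 1 ⊗ m`. -/
def pullbackMk : M →ₛₗ[σ] Pullback σ M where
  toFun m := ((1 : Twist σ) ⊗ₜ[S] m : Twist σ ⊗[S] M)
  map_add' x y := TensorProduct.tmul_add _ _ _
  map_smul' s m := by
    change ((1 : Twist σ) ⊗ₜ[S] (s • m) : Twist σ ⊗[S] M) =
      toTwist σ (σ s) • ((1 : Twist σ) ⊗ₜ[S] m : Twist σ ⊗[S] M)
    rw [← algebraMap_twist, algebraMap_smul, TensorProduct.tmul_smul]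

lemma pullback_induction {p : Pullback σ M → Prop} (h0 : p 0)
    (hs : ∀ (s : S) (m : M), p (s • pullbackMk σ m)) (ha : ∀ x y, p x → p y → p (x + y))
    (x : Pullback σ M) : p x := by
  refine TensorProduct.induction_on (motive := fun x : Twist σ ⊗[S] M => p x) x h0 ?_ ha
  intro t m
  have h := hs ((toTwist σ).symm t) m
  have e : (toTwist σ).symm t • pullbackMk σ m = (t ⊗ₜ[S] m : Twist σ ⊗[S] M) := by
    change t • ((1 : Twist σ) ⊗ₜ[S] m : Twist σ ⊗[S] M) = _
    rw [TensorProduct.smul_tmul', smul_eq_mul, mul_one]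
  rwa [e] at h

variable {σ}

lemma pullback_hom_ext {f g : Pullback σ M →ₗ[S] Q}
    (h : ∀ m, f (pullbackMk σ m) = g (pullbackMk σ m)) : f = g := by
  ext x
  induction x using pullback_induction with
  | h0 => simp
  | hs s m => simp [h]
  | ha x y hx hy => simp [hx, hy]

/-- The linear map `σ^* M → Q`, `s ⊗ m ↦ s • g m`, attached to a `σ`-semilinear map `g`. -/
def pullbackLift (g : M →ₛₗ[σ] Q) : Pullback σ M →ₗ[S] Q :=
  let F : Twist σ ⊗[S] M →+ Q := TensorProduct.liftAddHom
    { toFun := fun t =>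
        { toFun := fun m => (toTwist σ).symm t • g m
          map_zero' := by simp
          map_add' := by simp }
      map_zero' := by ext m; simp
      map_add' := fun s t => by ext m; simp [add_smul] }
    (by
      intro r t m
      change (toTwist σ).symm (r • t) • g m = (toTwist σ).symm t • g (r • m)
      rw [Algebra.smul_def, algebraMap_twist, map_mul, RingEquiv.symm_apply_apply,
        LinearMap.map_smulₛₗ, mul_comm, mul_smul])
  { toFun := F
    map_add' := F.map_add
    map_smul' := by
      intro s x
      refine TensorProduct.induction_on (motive := fun x : Twist σ ⊗[S] M =>
        F (toTwist σ s • x) = s • F x) x (by simp) ?_ ?_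
      · intro t m
        change (toTwist σ).symm (toTwist σ s * t) • g m = s • (toTwist σ).symm t • g m
        rw [map_mul, RingEquiv.symm_apply_apply, mul_smul]
      · intro x y hx hy
        rw [smul_add, F.map_add, F.map_add, hx, hy, smul_add] }

@[simp] lemma pullbackLift_mk (g : M →ₛₗ[σ] Q) (m : M) :
    pullbackLift g (pullbackMk σ m) = g m := by
  change (toTwist σ).symm 1 • g m = g m
  rw [map_one, one_smul]

variable (σ) in
/-- The pullback `σ^* f : σ^* M → σ^* N`, `s ⊗ m ↦ s ⊗ f m`, of a linear map `f : M → N`. -/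
def pullbackMap (f : M →ₗ[S] N) : Pullback σ M →ₗ[S] Pullback σ N :=
  pullbackLift ((pullbackMk σ).comp f)

@[simp] lemma pullbackMap_mk (f : M →ₗ[S] N) (m : M) :
    pullbackMap σ f (pullbackMk σ m) = pullbackMk σ (f m) := by
  simp [pullbackMap]

end Pullback

/-! ### Extension of scalars between `S`-algebras -/

section ExtendScalars

variable {S P B : Type*} [CommRing S] [CommRing P] [CommRing B] [Algebra S P] [Algebra S B]
  {M N N' : Type*} [AddCommGroup M] [Module S M] [AddCommGroup N] [Module S N]
  [AddCommGroup N'] [Module S N']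

/-- The `B`-linear map `B ⊗ M → B ⊗ N` obtained from a `P`-linear map `P ⊗ M → P ⊗ N` by extension
of scalars along a homomorphism `P → B` of `S`-algebras. -/
def extendScalars (φ : P →ₐ[S] B) (g : P ⊗[S] M →ₗ[P] P ⊗[S] N) : B ⊗[S] M →ₗ[B] B ⊗[S] N :=
  ((φ.toLinearMap.rTensor N).comp
    ((g.restrictScalars S).comp (TensorProduct.mk S P M 1))).liftBaseChange B

lemma rTensor_smul (φ : P →ₐ[S] B) (p : P) (x : P ⊗[S] N) :
    φ.toLinearMap.rTensor N (p • x) = φ p • φ.toLinearMap.rTensor N x := by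
  induction x with
  | zero => simp
  | tmul a n => simp [TensorProduct.smul_tmul']
  | add x y hx hy => simp only [smul_add, map_add, hx, hy]

lemma extendScalars_rTensor (φ : P →ₐ[S] B) (g : P ⊗[S] M →ₗ[P] P ⊗[S] N) (x : P ⊗[S] M) :
    extendScalars φ g (φ.toLinearMap.rTensor M x) = φ.toLinearMap.rTensor N (g x) := by
  induction x with
  | zero => simp
  | tmul a m =>
    have : a ⊗ₜ[S] m = a • ((1 : P) ⊗ₜ[S] m) := by simp [TensorProduct.smul_tmul']
    conv_rhs => rw [this, map_smul, rTensor_smul]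
    simp [extendScalars]
  | add x y hx hy => simp only [map_add, hx, hy]

lemma extendScalars_one_tmul (φ : P →ₐ[S] B) (g : P ⊗[S] M →ₗ[P] P ⊗[S] N) (m : M) :
    extendScalars φ g (1 ⊗ₜ m) = φ.toLinearMap.rTensor N (g (1 ⊗ₜ m)) := by
  simp [extendScalars]

lemma extendScalars_comp (φ : P →ₐ[S] B) (h : P ⊗[S] N →ₗ[P] P ⊗[S] N')
    (g : P ⊗[S] M →ₗ[P] P ⊗[S] N) :
    extendScalars φ (h ∘ₗ g) = extendScalars φ h ∘ₗ extendScalars φ g := by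
  ext m
  simp [extendScalars_one_tmul, extendScalars_rTensor]

lemma extendScalars_add (φ : P →ₐ[S] B) (g h : P ⊗[S] M →ₗ[P] P ⊗[S] N) :
    extendScalars φ (g + h) = extendScalars φ g + extendScalars φ h := by
  ext m
  simp [extendScalars_one_tmul]

lemma extendScalars_smul_id (φ : P →ₐ[S] B) (p : P) :
    extendScalars φ (p • (LinearMap.id : P ⊗[S] M →ₗ[P] P ⊗[S] M)) = φ p • LinearMap.id := by
  ext m
  simp [extendScalars_one_tmul, rTensor_smul]

end ExtendScalars

/-! ### Power series and Laurent series -/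

section Series

/-- The ring homomorphism `R((z)) → R'((z))` applying `f : R → R'` to the coefficients, obtained
from `R⟦z⟧ → R'⟦z⟧` by inverting `z`. -/
def laurentMap {R R' : Type*} [CommRing R] [CommRing R'] (f : R →+* R') : R⸨X⸩ →+* R'⸨X⸩ :=
  IsLocalization.map (M := Submonoid.powers (PowerSeries.X : R⟦X⟧))
    (T := Submonoid.powers (PowerSeries.X : R'⟦X⟧)) R'⸨X⸩ (PowerSeries.map f)
    (by rw [Submonoid.powers_le]; exact ⟨1, by simp⟩)

lemma laurentMap_algebraMap {R R' : Type*} [CommRing R] [CommRing R'] (f : R →+* R') (x : R⟦X⟧) :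
    laurentMap f (algebraMap R⟦X⟧ R⸨X⸩ x) = algebraMap R'⟦X⟧ R'⸨X⸩ (PowerSeries.map f x) :=
  IsLocalization.map_eq _ x

variable (Fv R : Type*) [Field Fv] [Fintype Fv] [CommRing R] [Algebra Fv R]

/-- The `q_v`-Frobenius `b ↦ b ^ q_v` of `R`, where `q_v` is the cardinality of `Fv`. -/
abbrev frob : R →+* R := (FiniteField.frobeniusAlgHom Fv R : R →+* R)

/-- The endomorphism `σ̂` of `R⟦z⟧` with `σ̂(z) = z` and `σ̂(b) = b ^ q_v` for `b ∈ R`. -/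
def sigmaHat : R⟦X⟧ →+* R⟦X⟧ := PowerSeries.map (frob Fv R)

/-- The extension of `σ̂` to `R⟦z⟧[1/z]`. -/
def sigmaHatLaurent : R⸨X⸩ →+* R⸨X⸩ := laurentMap (frob Fv R)

/-- The inclusion `Q_v = Fv((z)) → R⟦z⟧[1/z]`. -/
def constLaurent : Fv⸨X⸩ →+* R⸨X⸩ := laurentMap (algebraMap Fv R)

/-- The inclusion `A_v = Fv⟦z⟧ → R⟦z⟧`. -/
def constPower : Fv⟦X⟧ →+* R⟦X⟧ := PowerSeries.map (algebraMap Fv R)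

lemma sigmaHat_constPower (c : Fv⟦X⟧) : sigmaHat Fv R (constPower Fv R c) = constPower Fv R c := by
  ext n
  simp [sigmaHat, constPower]

lemma sigmaHatLaurent_constLaurent (c : Fv⸨X⸩) :
    sigmaHatLaurent Fv R (constLaurent Fv R c) = constLaurent Fv R c := by
  have : (sigmaHatLaurent Fv R).comp (constLaurent Fv R) = constLaurent Fv R := by
    refine IsLocalization.ringHom_ext (Submonoid.powers (PowerSeries.X : Fv⟦X⟧)) ?_
    ext1 x
    have h := sigmaHat_constPower Fv R x
    simp only [sigmaHat, constPower] at h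
    simp only [RingHom.comp_apply, sigmaHatLaurent, constLaurent, laurentMap_algebraMap, h]
  exact RingHom.congr_fun this c

variable {R}

/-- The ring `R⟦z⟧[1/(z - ζ)]`. -/
abbrev AwayZeta (ζ : R) : Type _ :=
  Localization.Away (PowerSeries.X - PowerSeries.C ζ : R⟦X⟧)

/-- The ring `R⟦z⟧[1/z][1/(z - ζ)]`. -/
abbrev AwayBoth (ζ : R) : Type _ :=
  Localization.Away (algebraMap R⟦X⟧ R⸨X⸩ (PowerSeries.X - PowerSeries.C ζ))

/-- The localization map `R⟦z⟧[1/z] → R⟦z⟧[1/z][1/(z - ζ)]`. -/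
def laurentToBoth (ζ : R) : R⸨X⸩ →ₐ[R⟦X⟧] AwayBoth ζ :=
  IsScalarTower.toAlgHom R⟦X⟧ R⸨X⸩ (AwayBoth ζ)

/-- The localization map `R⟦z⟧[1/(z - ζ)] → R⟦z⟧[1/z][1/(z - ζ)]`. -/
def zetaToBoth (ζ : R) : AwayZeta ζ →ₐ[R⟦X⟧] AwayBoth ζ :=
  Localization.awayMapₐ (Algebra.ofId R⟦X⟧ R⸨X⸩) (PowerSeries.X - PowerSeries.C ζ : R⟦X⟧)

end Series

/-! ### Pullback of maps between `z`-localized modules -/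

section PullbackLaurent

variable (Fv : Type*) {R : Type*} [Field Fv] [Fintype Fv] [CommRing R] [Algebra Fv R]
  {M N N' : Type*} [AddCommGroup M] [Module R⟦X⟧ M] [AddCommGroup N] [Module R⟦X⟧ N]
  [AddCommGroup N'] [Module R⟦X⟧ N']

/-- `σ̂` on `R⟦z⟧[1/z]` as a semilinear map of `R⟦z⟧`-modules. -/
def sigmaHatLaurentₛₗ : R⸨X⸩ →ₛₗ[sigmaHat Fv R] R⸨X⸩ where
  toFun := sigmaHatLaurent Fv R
  map_add' := map_add _
  map_smul' s p := by
    simp only [Algebra.smul_def, map_mul]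
    simp only [sigmaHatLaurent, laurentMap_algebraMap, sigmaHat]

/-- The semilinear map `N[1/z] → (σ̂^* N)[1/z]`, `p ⊗ n ↦ σ̂(p) ⊗ (1 ⊗ n)`. -/
def pullbackMkLaurent :
    R⸨X⸩ ⊗[R⟦X⟧] N →ₛₗ[sigmaHat Fv R] R⸨X⸩ ⊗[R⟦X⟧] Pullback (sigmaHat Fv R) N :=
  TensorProduct.map (sigmaHatLaurentₛₗ Fv) (pullbackMk (sigmaHat Fv R))

/-- The pullback `σ̂^* f : (σ̂^* M)[1/z] → (σ̂^* N)[1/z]` of a linear map `f : M[1/z] → N[1/z]`; it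
sends `1 ⊗ (1 ⊗ m)` to the image of `f (1 ⊗ m)` under `N[1/z] → (σ̂^* N)[1/z]`. -/
def pullbackMapLaurent (f : R⸨X⸩ ⊗[R⟦X⟧] M →ₗ[R⸨X⸩] R⸨X⸩ ⊗[R⟦X⟧] N) :
    R⸨X⸩ ⊗[R⟦X⟧] Pullback (sigmaHat Fv R) M →ₗ[R⸨X⸩]
      R⸨X⸩ ⊗[R⟦X⟧] Pullback (sigmaHat Fv R) N :=
  (pullbackLift ((pullbackMkLaurent Fv).comp
    ((f.restrictScalars R⟦X⟧).comp (TensorProduct.mk R⟦X⟧ R⸨X⸩ M 1)))).liftBaseChange R⸨X⸩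

lemma pullbackMapLaurent_one_tmul (f : R⸨X⸩ ⊗[R⟦X⟧] M →ₗ[R⸨X⸩] R⸨X⸩ ⊗[R⟦X⟧] N) (m : M) :
    pullbackMapLaurent Fv f (1 ⊗ₜ pullbackMk _ m) = pullbackMkLaurent Fv (f (1 ⊗ₜ m)) := by
  simp [pullbackMapLaurent]

lemma pullbackMkLaurent_smul (p : R⸨X⸩) (x : R⸨X⸩ ⊗[R⟦X⟧] N) :
    pullbackMkLaurent Fv (p • x) = sigmaHatLaurent Fv R p • pullbackMkLaurent Fv x := by
  induction x with
  | zero => simp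
  | tmul a n => simp [TensorProduct.smul_tmul', pullbackMkLaurent, sigmaHatLaurentₛₗ]
  | add x y hx hy => simp only [smul_add, map_add, hx, hy]

lemma pullbackMapLaurent_mk (f : R⸨X⸩ ⊗[R⟦X⟧] M →ₗ[R⸨X⸩] R⸨X⸩ ⊗[R⟦X⟧] N)
    (x : R⸨X⸩ ⊗[R⟦X⟧] M) :
    pullbackMapLaurent Fv f (pullbackMkLaurent Fv x) = pullbackMkLaurent Fv (f x) := by
  induction x with
  | zero => simp
  | tmul a m =>
    have : a ⊗ₜ[R⟦X⟧] m = a • ((1 : R⸨X⸩) ⊗ₜ[R⟦X⟧] m) := by simp [TensorProduct.smul_tmul']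
    have h1 : pullbackMkLaurent Fv ((1 : R⸨X⸩) ⊗ₜ[R⟦X⟧] m) = 1 ⊗ₜ pullbackMk _ m := by
      simp [pullbackMkLaurent, sigmaHatLaurentₛₗ]
    rw [this, pullbackMkLaurent_smul, map_smul, map_smul, pullbackMkLaurent_smul, h1,
      pullbackMapLaurent_one_tmul]
  | add x y hx hy => simp only [map_add, hx, hy]

lemma laurent_hom_ext {Q : Type*} [AddCommGroup Q] [Module R⟦X⟧ Q] [Module R⸨X⸩ Q]
    [IsScalarTower R⟦X⟧ R⸨X⸩ Q]
    {f g : R⸨X⸩ ⊗[R⟦X⟧] Pullback (sigmaHat Fv R) M →ₗ[R⸨X⸩] Q}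
    (h : ∀ m, f (1 ⊗ₜ pullbackMk _ m) = g (1 ⊗ₜ pullbackMk _ m)) : f = g := by
  refine TensorProduct.AlgebraTensorModule.curry_injective (LinearMap.ext_ring ?_)
  exact pullback_hom_ext h

lemma pullbackMapLaurent_comp (g : R⸨X⸩ ⊗[R⟦X⟧] N →ₗ[R⸨X⸩] R⸨X⸩ ⊗[R⟦X⟧] N')
    (f : R⸨X⸩ ⊗[R⟦X⟧] M →ₗ[R⸨X⸩] R⸨X⸩ ⊗[R⟦X⟧] N) :
    pullbackMapLaurent Fv (g ∘ₗ f) = pullbackMapLaurent Fv g ∘ₗ pullbackMapLaurent Fv f := by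
  refine laurent_hom_ext Fv fun m => ?_
  simp [pullbackMapLaurent_one_tmul, pullbackMapLaurent_mk]

lemma pullbackMapLaurent_add (f g : R⸨X⸩ ⊗[R⟦X⟧] M →ₗ[R⸨X⸩] R⸨X⸩ ⊗[R⟦X⟧] N) :
    pullbackMapLaurent Fv (f + g) = pullbackMapLaurent Fv f + pullbackMapLaurent Fv g := by
  refine laurent_hom_ext Fv fun m => ?_
  simp [pullbackMapLaurent_one_tmul]

lemma pullbackMapLaurent_smul_id (p : R⸨X⸩) :
    pullbackMapLaurent Fv (p • (LinearMap.id : R⸨X⸩ ⊗[R⟦X⟧] M →ₗ[R⸨X⸩] R⸨X⸩ ⊗[R⟦X⟧] M)) =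
      sigmaHatLaurent Fv R p • LinearMap.id := by
  refine laurent_hom_ext Fv fun m => ?_
  rw [pullbackMapLaurent_one_tmul, LinearMap.smul_apply, pullbackMkLaurent_smul]
  simp [pullbackMkLaurent, sigmaHatLaurentₛₗ]

end PullbackLaurent

end LocSht

/-! ### Local shtukas -/

open LocSht

/-- A local `σ̂`-shtuka over `R`: a finite free `R⟦z⟧`-module `M` together with an isomorphism
`τ : (σ̂^* M)[1/(z - ζ)] ≃ M[1/(z - ζ)]`. -/
structure LocalShtuka (Fv : Type u) {R : Type v} [Field Fv] [Fintype Fv] [CommRing R]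
    [Algebra Fv R] (ζ : R) where
  /-- the underlying module -/
  carrier : Type w
  [addCommGroup : AddCommGroup carrier]
  [module : Module R⟦X⟧ carrier]
  [free : Module.Free R⟦X⟧ carrier]
  [finite : Module.Finite R⟦X⟧ carrier]
  /-- the isomorphism `τ` -/
  τ : AwayZeta ζ ⊗[R⟦X⟧] Pullback (sigmaHat Fv R) carrier ≃ₗ[AwayZeta ζ]
    AwayZeta ζ ⊗[R⟦X⟧] carrier

namespace LocalShtuka

attribute [instance] addCommGroup module free finite

variable {Fv R : Type*} [Field Fv] [Fintype Fv] [CommRing R] [Algebra Fv R] {ζ : R}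

/-- The rank of a local shtuka. -/
def rank (M : LocalShtuka Fv ζ) : ℕ := Module.finrank R⟦X⟧ M.carrier

/-- The module `M[1/z]`. -/
abbrev Laurent (M : LocalShtuka Fv ζ) : Type _ := R⸨X⸩ ⊗[R⟦X⟧] M.carrier

/-- `f : M → N` is a morphism of local shtukas: `τ_N ∘ σ̂^* f = f ∘ τ_M`. -/
def IsMorphism (M N : LocalShtuka Fv ζ) (f : M.carrier →ₗ[R⟦X⟧] N.carrier) : Prop :=
  (N.τ : _ →ₗ[AwayZeta ζ] _) ∘ₗ (pullbackMap (sigmaHat Fv R) f).baseChange (AwayZeta ζ) =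
    f.baseChange (AwayZeta ζ) ∘ₗ (M.τ : _ →ₗ[AwayZeta ζ] _)

/-- `f : M[1/z] → N[1/z]` is a quasi-morphism of local shtukas: `τ_N ∘ σ̂^* f = f ∘ τ_M`, as maps
`(σ̂^* M)[1/z][1/(z - ζ)] → N[1/z][1/(z - ζ)]`. -/
def IsQuasiMorphism (M N : LocalShtuka Fv ζ) (f : M.Laurent →ₗ[R⸨X⸩] N.Laurent) : Prop :=
  extendScalars (zetaToBoth ζ) (N.τ : _ →ₗ[AwayZeta ζ] _) ∘ₗ
      extendScalars (laurentToBoth ζ) (pullbackMapLaurent Fv f) =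
    extendScalars (laurentToBoth ζ) f ∘ₗ
      extendScalars (zetaToBoth ζ) (M.τ : _ →ₗ[AwayZeta ζ] _)

/-- A quasi-isogeny from `M` to `N`: an isomorphism `M[1/z] ≃ N[1/z]` that is a quasi-morphism. -/
structure QuasiIsogeny (M N : LocalShtuka Fv ζ) where
  /-- the underlying isomorphism -/
  toLinearEquiv : M.Laurent ≃ₗ[R⸨X⸩] N.Laurent
  isQuasiMorphism : IsQuasiMorphism M N toLinearEquiv

lemma isMorphism_smul_id (M : LocalShtuka Fv ζ) {s : R⟦X⟧} (hs : sigmaHat Fv R s = s) :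
    IsMorphism M M (s • LinearMap.id) := by
  have h : pullbackMap (sigmaHat Fv R) (s • (LinearMap.id : M.carrier →ₗ[R⟦X⟧] M.carrier)) =
      s • LinearMap.id := by
    refine pullback_hom_ext fun m => ?_
    simp [LinearMap.map_smulₛₗ, hs]
  unfold IsMorphism
  rw [h]
  simp only [LinearMap.baseChange_smul, LinearMap.baseChange_id]
  ext m
  exact LinearMap.map_smul_of_tower M.τ.toLinearMap s (1 ⊗ₜ[R⟦X⟧] m)

lemma isQuasiMorphism_smul_id (M : LocalShtuka Fv ζ) {p : R⸨X⸩}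
    (hp : sigmaHatLaurent Fv R p = p) : IsQuasiMorphism M M (p • LinearMap.id) := by
  unfold IsQuasiMorphism
  rw [pullbackMapLaurent_smul_id, hp, extendScalars_smul_id, extendScalars_smul_id]
  ext m
  simp

/-- The ring `End_R(M)` of endomorphisms of a local shtuka. -/
def End (M : LocalShtuka Fv ζ) : Subring (Module.End R⟦X⟧ M.carrier) where
  carrier := {f | IsMorphism M M f}
  one_mem' := by
    have := isMorphism_smul_id M (s := 1) (by simp)
    rwa [one_smul] at this
  zero_mem' := by
    have := isMorphism_smul_id M (s := 0) (by simp)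
    rwa [zero_smul] at this
  mul_mem' := by
    intro f g hf hg
    simp only [Set.mem_ofPred_eq, IsMorphism] at hf hg ⊢
    have h : pullbackMap (sigmaHat Fv R) (f * g) =
        pullbackMap (sigmaHat Fv R) f ∘ₗ pullbackMap (sigmaHat Fv R) g :=
      pullback_hom_ext fun m => by simp
    rw [h, LinearMap.baseChange_comp, ← LinearMap.comp_assoc, hf, LinearMap.comp_assoc, hg,
      Module.End.mul_eq_comp, LinearMap.baseChange_comp, LinearMap.comp_assoc]
  add_mem' := by
    intro f g hf hg
    simp only [Set.mem_ofPred_eq, IsMorphism] at hf hg ⊢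
    have h : pullbackMap (sigmaHat Fv R) (f + g) =
        pullbackMap (sigmaHat Fv R) f + pullbackMap (sigmaHat Fv R) g :=
      pullback_hom_ext fun m => by simp
    rw [h, LinearMap.baseChange_add, LinearMap.comp_add, hf, hg, LinearMap.baseChange_add,
      LinearMap.add_comp]
  neg_mem' := by
    intro f hf
    simp only [Set.mem_ofPred_eq, IsMorphism] at hf ⊢
    have h : pullbackMap (sigmaHat Fv R) (-f) = -pullbackMap (sigmaHat Fv R) f :=
      pullback_hom_ext fun m => by simp
    rw [h, LinearMap.baseChange_neg, LinearMap.comp_neg, hf, LinearMap.baseChange_neg,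
      LinearMap.neg_comp]

/-- The `A_v`-algebra structure of `End_R(M)`, by scalar multiplication. -/
instance (M : LocalShtuka Fv ζ) : Algebra Fv⟦X⟧ M.End :=
  RingHom.toAlgebra'
    (((algebraMap R⟦X⟧ (Module.End R⟦X⟧ M.carrier)).comp (constPower Fv R)).codRestrict M.End
      fun c => isMorphism_smul_id M (sigmaHat_constPower Fv R c))
    fun c f => Subtype.ext (Algebra.commutes (constPower Fv R c) f.1)

/-- The ring `QEnd_R(M)` of quasi-endomorphisms of a local shtuka. -/
def QEnd (M : LocalShtuka Fv ζ) : Subring (Module.End R⸨X⸩ M.Laurent) where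
  carrier := {f | IsQuasiMorphism M M f}
  one_mem' := by
    have := isQuasiMorphism_smul_id M (p := 1) (by simp)
    rwa [one_smul] at this
  zero_mem' := by
    have := isQuasiMorphism_smul_id M (p := 0) (by simp)
    rwa [zero_smul] at this
  mul_mem' := by
    intro f g hf hg
    simp only [Set.mem_ofPred_eq, IsQuasiMorphism] at hf hg ⊢
    rw [Module.End.mul_eq_comp, pullbackMapLaurent_comp, extendScalars_comp, ← LinearMap.comp_assoc,
      hf, LinearMap.comp_assoc, hg, extendScalars_comp, LinearMap.comp_assoc]
  add_mem' := by
    intro f g hf hg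
    simp only [Set.mem_ofPred_eq, IsQuasiMorphism] at hf hg ⊢
    rw [pullbackMapLaurent_add, extendScalars_add, LinearMap.comp_add, hf, hg, extendScalars_add,
      LinearMap.add_comp]
  neg_mem' := by
    intro f hf
    have h := isQuasiMorphism_smul_id M (p := -1) (by simp)
    simp only [Set.mem_ofPred_eq, IsQuasiMorphism] at hf h ⊢
    have e : -f = ((-1 : R⸨X⸩) • LinearMap.id) ∘ₗ f := by ext; simp
    rw [e, pullbackMapLaurent_comp, extendScalars_comp, ← LinearMap.comp_assoc,
      h, LinearMap.comp_assoc, hf, extendScalars_comp, LinearMap.comp_assoc]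

/-- The `Q_v`-algebra structure of `QEnd_R(M)`, by scalar multiplication. -/
instance (M : LocalShtuka Fv ζ) : Algebra Fv⸨X⸩ M.QEnd :=
  RingHom.toAlgebra'
    (((algebraMap R⸨X⸩ (Module.End R⸨X⸩ M.Laurent)).comp (constLaurent Fv R)).codRestrict M.QEnd
      fun c => isQuasiMorphism_smul_id M (sigmaHatLaurent_constLaurent Fv R c))
    fun c f => Subtype.ext (Algebra.commutes (constLaurent Fv R c) f.1)

/-- `M` has complex multiplication by the commutative semi-simple `Q_v`-algebra `E`, by means of
the embedding `ι : E → QEnd_R(M)`. -/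
structure IsCM (M : LocalShtuka Fv ζ) {E : Type*} [CommRing E] [Algebra Fv⸨X⸩ E]
    (ι : E →ₐ[Fv⸨X⸩] M.QEnd) : Prop where
  isSemisimpleRing : IsSemisimpleRing E
  finite : Module.Finite Fv⸨X⸩ E
  finrank_eq : Module.finrank Fv⸨X⸩ E = M.rank
  injective : Function.Injective ι

end LocalShtuka

end

/-! The idea is to replace the lattice `M` inside `M[1/z]` by a larger one that is stable under both
`τ` and the integral closure `O` of `Fv⟦X⟧` in `E`. The natural candidate is the `O`-span `L` of
`M`. Two things must be checked: that `L` is bounded, and that it can be made free over `R⟦X⟧`.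

Boundedness: `O` is finitely generated over `Fv⟦X⟧`, even for inseparable `E`
(`fg_integralClosure`), because it contains no nonzero infinitely `X`-divisible element. Hence one
power of `X` clears the denominators of all matrices of elements of `O`.

Freeness: `L` need not be free, so it is enlarged to its saturation, the vectors that some nonzero
constant of `R` carries into `L`. The saturation obeys the same bound, since `X` is prime to
constants. Its reduction modulo `X` is finitely generated and torsion-free over the principal ideal
domain `R`, hence free, and a basis of the reduction lifts (`free_of_saturated`). It is still stable
under `O`, and also under `τ` because Frobenius is injective on `R`.

In matrices (`exists_integral_conjugate`): let `T` be the matrix of `(z - ζ)^n τ`, integral for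
suitable `n`, and let the columns of `B` be a basis of the saturated lattice. Stability says that
`T' = B⁻¹ T σ̂(B)` and `B⁻¹ A B` are integral, for `A` in the image of `O`. Units of `R⟦X⟧[1/X]` are
powers of `X` times units of `R⟦X⟧`, so `σ̂(det B) / det B` is a unit of `R⟦X⟧`. Thus `det T'` stays
invertible away from `z - ζ`, and `(z - ζ)⁻ⁿ T'` defines the new shtuka, with quasi-isogeny `B⁻¹`.
-/

noncomputable section

namespace LocSht

/-! ### Lifting bases from the reduction modulo `X`. -/

section ModX

variable (R N : Type*) [CommRing R] [AddCommGroup N] [Module R⟦X⟧ N]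

/-- The quotient `N / X N` of an `R⟦X⟧`-module, regarded as an `R`-module. -/
def ModX : Type _ := N ⧸ (Ideal.span {(PowerSeries.X : R⟦X⟧)} • ⊤ : Submodule R⟦X⟧ N)

instance : AddCommGroup (ModX R N) :=
  inferInstanceAs (AddCommGroup (N ⧸ (Ideal.span {(PowerSeries.X : R⟦X⟧)} • ⊤ : Submodule R⟦X⟧ N)))

instance : Module R⟦X⟧ (ModX R N) :=
  inferInstanceAs (Module R⟦X⟧ (N ⧸ (Ideal.span {(PowerSeries.X : R⟦X⟧)} • ⊤ : Submodule R⟦X⟧ N)))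

instance : Module R (ModX R N) := Module.compHom _ (PowerSeries.C : R →+* R⟦X⟧)

lemma mem_span_X_smul_top {x : N} :
    x ∈ (Ideal.span {(PowerSeries.X : R⟦X⟧)} • ⊤ : Submodule R⟦X⟧ N) ↔
      ∃ y, x = (PowerSeries.X : R⟦X⟧) • y := by
  rw [Submodule.ideal_span_singleton_smul, Submodule.mem_smul_pointwise_iff_exists]
  simp [eq_comm]

/-- The projection `N → N / X N`. -/
def toModX : N →ₛₗ[PowerSeries.constantCoeff (R := R)] ModX R N where
  toFun := (Ideal.span {(PowerSeries.X : R⟦X⟧)} • ⊤ : Submodule R⟦X⟧ N).mkQ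
  map_add' := map_add _
  map_smul' f x := by
    change _ = (Ideal.span {(PowerSeries.X : R⟦X⟧)} • ⊤ : Submodule R⟦X⟧ N).mkQ
      (PowerSeries.C (PowerSeries.constantCoeff f) • x)
    rw [← sub_eq_zero, ← map_sub, ← sub_smul, Submodule.mkQ_apply, Submodule.Quotient.mk_eq_zero,
      mem_span_X_smul_top]
    obtain ⟨g, hg⟩ := PowerSeries.X_dvd_iff.2
      (show PowerSeries.constantCoeff (f - PowerSeries.C (PowerSeries.constantCoeff f)) = 0 by simp)
    exact ⟨g • x, by rw [hg, mul_smul]⟩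

lemma toModX_surjective : Function.Surjective (toModX R N) := Submodule.mkQ_surjective _

variable {R N}

lemma toModX_eq_zero_iff {x : N} : toModX R N x = 0 ↔ ∃ y, x = (PowerSeries.X : R⟦X⟧) • y := by
  rw [← mem_span_X_smul_top]
  exact Submodule.Quotient.mk_eq_zero _

/-- Reducing a relation modulo `X` shows that all its coefficients are divisible by `X`. Without
`X`-torsion the relation can be divided by `X` and the argument repeated, so the coefficients are
divisible by every power of `X` and vanish. -/
lemma linearIndependent_of_toModX (hX : ∀ x : N, (PowerSeries.X : R⟦X⟧) • x = 0 → x = 0)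
    {ι : Type*} {b : ι → N} (hb : LinearIndependent R (toModX R N ∘ b)) :
    LinearIndependent R⟦X⟧ b := by
  rw [linearIndependent_iff'] at hb ⊢
  intro s c hc i hi
  have key : ∀ (m : ℕ) (c : ι → R⟦X⟧), ∑ i ∈ s, c i • b i = 0 →
      ∀ i ∈ s, PowerSeries.X ^ m ∣ c i := by
    intro m
    induction m with
    | zero => simp
    | succ m ih =>
      intro c hc
      have h0 : ∀ i ∈ s, PowerSeries.constantCoeff (c i) = 0 := by
        refine hb s _ ?_
        simpa [LinearMap.map_smulₛₗ] using congrArg (toModX R N) hc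
      choose! d hd using fun i hi => PowerSeries.X_dvd_iff.2 (h0 i hi)
      have h1 : ∑ i ∈ s, d i • b i = 0 := by
        refine hX _ ?_
        rw [← hc, Finset.smul_sum]
        exact Finset.sum_congr rfl fun i hi => by rw [hd i hi, mul_smul]
      intro i hi
      rw [hd i hi, pow_succ']
      exact mul_dvd_mul_left _ (ih d h1 i hi)
  ext n
  simpa using PowerSeries.X_pow_dvd_iff.1 (key (n + 1) c hc i hi) n (Nat.lt_succ_self n)

lemma sup_span_X_smul_top_eq_top {ι : Type*} {b : ι → N}
    (hb : ⊤ ≤ Submodule.span R (Set.range (toModX R N ∘ b))) :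
    Submodule.span R⟦X⟧ (Set.range b) ⊔
      (Ideal.span {(PowerSeries.X : R⟦X⟧)} • ⊤ : Submodule R⟦X⟧ N) = ⊤ := by
  rw [eq_top_iff]
  intro x _
  have key : ∀ q ∈ Submodule.span R (Set.range (toModX R N ∘ b)),
      ∃ y ∈ Submodule.span R⟦X⟧ (Set.range b), toModX R N y = q := by
    intro q hq
    induction hq using Submodule.span_induction with
    | mem q hq =>
      obtain ⟨i, rfl⟩ := hq
      exact ⟨b i, Submodule.subset_span ⟨i, rfl⟩, rfl⟩
    | zero => exact ⟨0, zero_mem _, map_zero _⟩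
    | add q q' _ _ h h' =>
      obtain ⟨y, hy, rfl⟩ := h
      obtain ⟨y', hy', rfl⟩ := h'
      exact ⟨y + y', add_mem hy hy', map_add _ _ _⟩
    | smul r q _ h =>
      obtain ⟨y, hy, rfl⟩ := h
      exact ⟨PowerSeries.C r • y, Submodule.smul_mem _ _ hy, by simp [LinearMap.map_smulₛₗ]⟩
  obtain ⟨y, hy, h⟩ := key _ (hb (Submodule.mem_top (x := toModX R N x)))
  rw [← add_sub_cancel y x]
  refine Submodule.add_mem_sup hy ?_
  rw [mem_span_X_smul_top, ← toModX_eq_zero_iff, map_sub, h, sub_self]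

/-- The reduction is finitely generated and torsion-free over a principal ideal domain, hence has a
basis. Any lift of it is independent by the previous descent, and spans by Nakayama, since `X` lies
in the Jacobson radical of `R⟦X⟧`. -/
lemma free_of_modX [IsDomain R] [IsPrincipalIdealRing R] [Module.Finite R⟦X⟧ N]
    (hX : ∀ x : N, (PowerSeries.X : R⟦X⟧) • x = 0 → x = 0) [Module.IsTorsionFree R (ModX R N)] :
    Module.Free R⟦X⟧ N := by
  have : Module.Finite R (ModX R N) := Module.Finite.of_surjective _ (toModX_surjective R N)
  let c := Module.Free.chooseBasis R (ModX R N)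
  choose b hb using fun i => toModX_surjective R N (c i)
  have hb' : toModX R N ∘ b = c := funext hb
  refine Module.Free.of_basis (Module.Basis.mk (v := b) (linearIndependent_of_toModX hX ?_) ?_)
  · rw [hb']; exact c.linearIndependent
  · refine Submodule.le_of_le_smul_of_le_jacobson_bot Module.Finite.fg_top
      (IsAdicComplete.le_jacobson_bot (Ideal.span {(PowerSeries.X : R⟦X⟧)})) ?_
    rw [sup_span_X_smul_top_eq_top]
    rw [hb', c.span_eq]

end ModX

/-! ### Finiteness of the integral closure. -/

/-- Limits are taken coordinatewise; finiteness of `ι` makes congruence modulo `I ^ n` a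
coordinatewise condition. This supplies completeness of the source when surjectivity is lifted from
the reduction modulo `X`. -/
instance {R : Type*} [CommRing R] {I : Ideal R} [IsPrecomplete I R] {ι : Type*} [Finite ι] :
    IsPrecomplete I (ι → R) where
  prec' f hf := by
    have hmem : ∀ (n : ℕ) (x : ι → R),
        x ∈ (I ^ n • ⊤ : Submodule R (ι → R)) ↔ ∀ i, x i ∈ (I ^ n • ⊤ : Submodule R R) := by
      intro n x
      cases nonempty_fintype ι
      classical
      constructor
      · intro hx i
        have := Submodule.mem_map_of_mem (f := LinearMap.proj (R := R) (φ := fun _ : ι => R) i) hx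
        rw [Submodule.map_smul''] at this
        exact (smul_mono_right _ le_top : _ ≤ (I ^ n • ⊤ : Submodule R R)) this
      · intro h
        rw [pi_eq_sum_univ x]
        refine Submodule.sum_mem _ fun i _ => ?_
        have := h i
        simp only [smul_eq_mul, Ideal.mul_top] at this
        exact Submodule.smul_mem_smul this trivial
    have := fun i => IsPrecomplete.prec (I := I) (M := R) inferInstance (f := fun n => f n i)
      (fun {m n} hmn => by
        have := hf hmn
        rw [SModEq.sub_mem] at this ⊢
        exact (hmem m _).1 this i)
    choose L hL using this
    refine ⟨L, fun n => ?_⟩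
    rw [SModEq.sub_mem, hmem]
    intro i
    have := hL i n
    rwa [SModEq.sub_mem] at this

/-- Over a complete discretely valued field, a lattice without divisible elements in a
finite-dimensional vector space is finitely generated. -/
lemma fg_of_divisible_eq_zero {k E : Type*} [Field k] [AddCommGroup E] [Module k⟦X⟧ E]
    [Module k⸨X⸩ E] [IsScalarTower k⟦X⟧ k⸨X⸩ E] [Module.Finite k⸨X⸩ E] (N : Submodule k⟦X⟧ E)
    (hN : ∀ x : E, (∀ n : ℕ, ∃ y ∈ N, x = (PowerSeries.X : k⟦X⟧) ^ n • y) → x = 0) : N.FG := by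
  have hX : ∀ x : E, (PowerSeries.X : k⟦X⟧) • x = 0 → x = 0 := by
    intro x hx
    rw [← algebraMap_smul k⸨X⸩] at hx
    refine (smul_eq_zero.1 hx).resolve_left ?_
    simp
  have hX' : ∀ x : N, (PowerSeries.X : k⟦X⟧) • x = 0 → x = 0 := by
    intro x hx
    exact Subtype.ext (hX x (congrArg Subtype.val hx))
  let c := Module.Basis.ofVectorSpace k (ModX k N)
  choose b hb using fun i => toModX_surjective k N (c i)
  have hb' : toModX k N ∘ b = c := funext hb
  have hli : LinearIndependent k⟦X⟧ b :=
    linearIndependent_of_toModX hX' (by rw [hb']; exact c.linearIndependent)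
  -- Independence persists after inverting `X`, so the dimension of `E` bounds the number of lifted
  -- vectors.
  have hli' : LinearIndependent k⸨X⸩ (fun i => (b i : E)) :=
    LinearIndependent.localization k⸨X⸩ (Submonoid.powers (PowerSeries.X : k⟦X⟧))
      (hli.map' N.subtype N.ker_subtype)
  have := hli'.finite
  cases nonempty_fintype (Module.Basis.ofVectorSpaceIndex k (ModX k N))
  have : IsHausdorff (Ideal.span {(PowerSeries.X : k⟦X⟧)}) N :=
    ⟨fun x hx => Subtype.ext <| hN x fun n => by
    have := hx n
    rw [SModEq.zero, Ideal.span_singleton_pow, Submodule.ideal_span_singleton_smul,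
      Submodule.mem_smul_pointwise_iff_exists] at this
    obtain ⟨y, -, h⟩ := this
    exact ⟨y, y.2, by rw [← h]; rfl⟩⟩
  -- Nakayama would presuppose that `N` is finitely generated. Instead, successive approximation
  -- works: the source is `X`-adically complete, and the target is separated by `hN`.
  have hs : Function.Surjective (Fintype.linearCombination k⟦X⟧ b) := by
    refine surjective_of_mkQ_comp_surjective (I := Ideal.span {(PowerSeries.X : k⟦X⟧)}) ?_
    rw [← LinearMap.range_eq_top, LinearMap.range_comp, Fintype.range_linearCombination,
      ← sup_bot_eq (Submodule.map _ _), ← Submodule.mkQ_map_self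
        (Ideal.span {(PowerSeries.X : k⟦X⟧)} • ⊤ : Submodule k⟦X⟧ N), ← Submodule.map_sup,
      sup_span_X_smul_top_eq_top, Submodule.map_top, Submodule.range_mkQ]
    rw [hb', c.span_eq]
  exact Module.Finite.iff_fg.1 (Module.Finite.of_surjective _ hs)

/-- The integral closure of `k⟦X⟧` in a finite semisimple `k((X))`-algebra is finite over
`k⟦X⟧`. -/
lemma fg_integralClosure {k E : Type*} [Field k] [CommRing E] [Algebra k⸨X⸩ E]
    [Algebra k⟦X⟧ E] [IsScalarTower k⟦X⟧ k⸨X⸩ E] [IsSemisimpleRing E] [Module.Finite k⸨X⸩ E] :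
    (Subalgebra.toSubmodule (integralClosure k⟦X⟧ E)).FG := by
  refine fg_of_divisible_eq_zero _ fun x hx => ?_
  -- The infinitely `X`-divisible elements form an ideal of all of `E`: any `c` becomes integral
  -- after multiplication by some `X ^ m`, and that power is borrowed from the divisibility of `a`.
  let W : Ideal E :=
    { carrier := {x | ∀ n : ℕ, ∃ y ∈ Subalgebra.toSubmodule (integralClosure k⟦X⟧ E),
        x = (PowerSeries.X : k⟦X⟧) ^ n • y}
      zero_mem' := fun n => ⟨0, zero_mem _, (smul_zero _).symm⟩
      add_mem' := by
        intro a b ha hb n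
        obtain ⟨y, hy, rfl⟩ := ha n
        obtain ⟨y', hy', rfl⟩ := hb n
        exact ⟨y + y', add_mem hy hy', (smul_add _ _ _).symm⟩
      smul_mem' := by
        intro c a ha n
        have hc : IsAlgebraic k⸨X⸩ c := Algebra.IsAlgebraic.isAlgebraic c
        obtain ⟨⟨_, m, rfl⟩, hm⟩ := IsIntegral.exists_multiple_integral_of_isLocalization
          (Submonoid.powers (PowerSeries.X : k⟦X⟧)) c hc.isIntegral
        obtain ⟨y, hy, rfl⟩ := ha (n + m)
        refine ⟨((PowerSeries.X : k⟦X⟧) ^ m • c) * y, IsIntegral.mul hm hy, ?_⟩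
        simp only [smul_eq_mul, Algebra.smul_def, pow_add, map_mul]
        ring }
  -- Semisimplicity gives an idempotent generator. If it were nonzero, then in a residue field where
  -- it becomes `1` the relation `e = X • y` with `y` integral would make `X⁻¹` integral over
  -- `k⟦X⟧`.
  obtain ⟨e, he, hW⟩ := IsSemisimpleRing.ideal_eq_span_idempotent W
  suffices e = 0 by
    have hxW : x ∈ W := hx
    rw [hW, this] at hxW
    simpa using hxW
  by_contra hne
  have heW : e ∈ W := hW ▸ Ideal.mem_span_singleton_self e
  obtain ⟨y, hy, hey⟩ := heW 1
  have hu : ¬ IsUnit (1 - e) := fun h => hne (by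
    have : (1 - e) * e = 0 := by rw [sub_mul, he.eq, one_mul, sub_self]
    exact (h.mul_right_eq_zero).1 this)
  obtain ⟨m, hm, hem⟩ := exists_max_ideal_of_mem_nonunits hu
  let := Ideal.Quotient.field m
  have h1 : (Ideal.Quotient.mk m) e = 1 := by
    rw [eq_comm, ← sub_eq_zero, ← map_one (Ideal.Quotient.mk m), ← map_sub]
    exact Ideal.Quotient.eq_zero_iff_mem.2 hem
  have ht : algebraMap k⟦X⟧ k⸨X⸩ PowerSeries.X ≠ 0 := by simp
  have hym : algebraMap k⸨X⸩ (E ⧸ m) (algebraMap k⟦X⟧ k⸨X⸩ PowerSeries.X)⁻¹ =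
      Ideal.Quotient.mk m y := by
    rw [map_inv₀]
    refine inv_eq_of_mul_eq_one_right ?_
    rw [← h1, hey, pow_one, Algebra.smul_def, map_mul, IsScalarTower.algebraMap_apply k⟦X⟧ k⸨X⸩ E]
    rfl
  have hint : IsIntegral k⟦X⟧ (algebraMap k⟦X⟧ k⸨X⸩ PowerSeries.X)⁻¹ := by
    rw [← isIntegral_algebraMap_iff (algebraMap k⸨X⸩ (E ⧸ m)).injective, hym]
    exact IsIntegral.map (Ideal.Quotient.mkₐ k⟦X⟧ m) hy
  obtain ⟨f, hf⟩ := IsIntegrallyClosed.isIntegral_iff.1 hint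
  have : f * PowerSeries.X = 1 := by
    apply FaithfulSMul.algebraMap_injective k⟦X⟧ k⸨X⸩
    rw [map_mul, hf, map_one, inv_mul_cancel₀ ht]
  simpa using congrArg PowerSeries.constantCoeff this

/-! ### Saturated lattices over `R⟦X⟧`. -/

section Lattice

variable {R : Type*} [CommRing R]

lemma isUnit_algebraMap_X : IsUnit (algebraMap R⟦X⟧ R⸨X⸩ PowerSeries.X) :=
  IsLocalization.map_units (M := Submonoid.powers (PowerSeries.X : R⟦X⟧)) R⸨X⸩
    ⟨PowerSeries.X, 1, pow_one _⟩

lemma exists_mul_X_pow_eq (a : R⸨X⸩) :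
    ∃ (s : R⟦X⟧) (k : ℕ), a * algebraMap R⟦X⟧ R⸨X⸩ PowerSeries.X ^ k = algebraMap R⟦X⟧ R⸨X⸩ s := by
  obtain ⟨⟨s, _, k, rfl⟩, h⟩ :=
    IsLocalization.surj (Submonoid.powers (PowerSeries.X : R⟦X⟧)) a
  exact ⟨s, k, by simpa using h⟩

lemma algebraMap_laurent_injective : Function.Injective (algebraMap R⟦X⟧ R⸨X⸩) :=
  HahnSeries.ofPowerSeries_injective

lemma X_smul_injective {V : Type*} [AddCommGroup V] [Module R⟦X⟧ V] [Module R⸨X⸩ V]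
    [IsScalarTower R⟦X⟧ R⸨X⸩ V] {x y : V}
    (h : (PowerSeries.X : R⟦X⟧) • x = (PowerSeries.X : R⟦X⟧) • y) : x = y := by
  rw [← algebraMap_smul R⸨X⸩, ← algebraMap_smul R⸨X⸩ _ y] at h
  exact (IsUnit.smul_left_cancel isUnit_algebraMap_X).1 h

lemma exists_X_smul_eq {V : Type*} [AddCommGroup V] [Module R⟦X⟧ V] [Module R⸨X⸩ V]
    [IsScalarTower R⟦X⟧ R⸨X⸩ V] (k : ℕ) (x : V) : ∃ y : V, x = (PowerSeries.X : R⟦X⟧) ^ k • y := by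
  obtain ⟨u, hu⟩ := (isUnit_algebraMap_X (R := R)).pow k
  refine ⟨(↑u⁻¹ : R⸨X⸩) • x, ?_⟩
  rw [← algebraMap_smul R⸨X⸩, map_pow, ← hu, smul_smul, Units.mul_inv, one_smul]

variable [IsDomain R]

/-- The prime `X` does not divide a nonzero constant, so multiplying by the constant cannot cancel a
pole in `X`. -/
lemma exists_algebraMap_of_C_mul {r : R} (hr : r ≠ 0) {a : R⸨X⸩} {s : R⟦X⟧}
    (h : algebraMap R⟦X⟧ R⸨X⸩ (PowerSeries.C r) * a = algebraMap R⟦X⟧ R⸨X⸩ s) :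
    ∃ s' : R⟦X⟧, a = algebraMap R⟦X⟧ R⸨X⸩ s' := by
  obtain ⟨f, k, hf⟩ := exists_mul_X_pow_eq a
  have h1 : PowerSeries.C r * f = PowerSeries.X ^ k * s := by
    apply algebraMap_laurent_injective
    rw [map_mul, map_mul, ← hf, ← h, map_pow]
    ring
  have h2 : PowerSeries.X ^ k ∣ f := by
    refine PowerSeries.X_prime.pow_dvd_of_dvd_mul_left k ?_ ⟨s, h1⟩
    rw [PowerSeries.X_dvd_iff]
    simpa using hr
  obtain ⟨s', rfl⟩ := h2
  refine ⟨s', ((isUnit_algebraMap_X (R := R)).pow k).mul_right_cancel ?_⟩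
  rw [hf, map_mul, map_pow, mul_comm]

/-- A ring homomorphism on coefficients changes a unit of `R⟦X⟧[1/X]` by a unit of `R⟦X⟧`. -/
lemma exists_laurentMap_eq_mul_unit (f : R →+* R) {a : R⸨X⸩} (ha : IsUnit a) :
    ∃ w : R⟦X⟧ˣ, laurentMap f a = a * algebraMap R⟦X⟧ R⸨X⸩ w := by
  obtain ⟨s, k, hs⟩ := exists_mul_X_pow_eq a
  obtain ⟨b, hb⟩ := ha.exists_right_inv
  obtain ⟨s', k', hs'⟩ := exists_mul_X_pow_eq b
  have h1 : s * s' = PowerSeries.X ^ (k + k') := by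
    apply algebraMap_laurent_injective
    rw [map_mul, ← hs, ← hs', map_pow, pow_add]
    linear_combination (algebraMap R⟦X⟧ R⸨X⸩ PowerSeries.X ^ k *
      algebraMap R⟦X⟧ R⸨X⸩ PowerSeries.X ^ k') * hb
  -- As a divisor of a power of the prime `X`, the numerator `s` is a power of `X` up to a unit `u`.
  -- Since `f` fixes `X`, it changes `s` only by `u / f(u)`.
  obtain ⟨m, -, u, hu⟩ := (dvd_prime_pow PowerSeries.X_prime _).1 ⟨s', h1.symm⟩
  have h2 := congrArg (PowerSeries.map f) hu
  rw [map_mul, map_pow, PowerSeries.map_X, ← hu] at h2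
  let v : R⟦X⟧ˣ := Units.map (PowerSeries.map f : R⟦X⟧ →* R⟦X⟧) u
  have h3 : PowerSeries.map f s = s * ↑(u * v⁻¹) := by
    have hv : PowerSeries.map f ↑u * ↑v⁻¹ = 1 := v.mul_inv
    rw [Units.val_mul, ← mul_assoc, ← h2, mul_assoc, hv, mul_one]
  refine ⟨u * v⁻¹, ((isUnit_algebraMap_X (R := R)).pow k).mul_right_cancel ?_⟩
  have h4 := congrArg (laurentMap f) hs
  rw [map_mul, map_pow, laurentMap_algebraMap, laurentMap_algebraMap, PowerSeries.map_X, h3,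
    map_mul, ← hs] at h4
  rw [h4]
  ring

variable [IsPrincipalIdealRing R] {I : Type*} [Fintype I]

/-- The bound embeds `L` in a finite module over the noetherian ring `R⟦X⟧`, which gives finiteness.
Saturation makes `L / X L` torsion-free over `R`, which gives freeness. -/
lemma free_of_saturated (L : Submodule R⟦X⟧ (I → R⸨X⸩))
    (hsat : ∀ (r : R) (x : I → R⸨X⸩), r ≠ 0 → (PowerSeries.C r : R⟦X⟧) • x ∈ L → x ∈ L)
    (m : ℕ) (hbd : ∀ x ∈ L, ∃ s : I → R⟦X⟧,
      (PowerSeries.X : R⟦X⟧) ^ m • x = fun i => algebraMap R⟦X⟧ R⸨X⸩ (s i)) :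
    Module.Free R⟦X⟧ L ∧ Module.Finite R⟦X⟧ L := by
  have hfin : Module.Finite R⟦X⟧ L := by
    let φ : L →ₗ[R⟦X⟧] (I → R⸨X⸩) :=
      (LinearMap.lsmul R⟦X⟧ (I → R⸨X⸩) ((PowerSeries.X : R⟦X⟧) ^ m)) ∘ₗ L.subtype
    let ψ : (I → R⟦X⟧) →ₗ[R⟦X⟧] (I → R⸨X⸩) :=
      LinearMap.compLeft (Algebra.linearMap R⟦X⟧ R⸨X⸩) I
    have hφ : Function.Injective φ := by
      intro x y h
      refine Subtype.ext ?_
      have h' : (PowerSeries.X : R⟦X⟧) ^ m • (x : I → R⸨X⸩) = (PowerSeries.X : R⟦X⟧) ^ m • y := h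
      rw [← algebraMap_smul R⸨X⸩, ← algebraMap_smul R⸨X⸩ _ (y : I → R⸨X⸩), map_pow] at h'
      exact (IsUnit.smul_left_cancel (isUnit_algebraMap_X.pow m)).1 h'
    have : Module.Finite R⟦X⟧ (LinearMap.range ψ) := inferInstance
    refine Module.Finite.of_injective (φ.codRestrict (LinearMap.range ψ) fun x => ?_) ?_
    · obtain ⟨s, hs⟩ := hbd x x.2
      exact ⟨s, hs.symm⟩
    · intro x y h
      exact hφ (congrArg Subtype.val h)
  have htf : Module.IsTorsionFree R (ModX R L) := by
    refine ⟨fun r hr => ?_⟩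
    rw [isSMulRegular_iff_right_eq_zero_of_smul]
    intro q hq
    obtain ⟨x, rfl⟩ := toModX_surjective R L q
    have h1 : toModX R L ((PowerSeries.C r : R⟦X⟧) • x) = 0 := by
      rw [LinearMap.map_smulₛₗ]; simpa using hq
    obtain ⟨y, hy⟩ := toModX_eq_zero_iff.1 h1
    -- In the ambient space `x` can be divided by `X`. The quotient `w` has a nonzero constant
    -- multiple in `L`, so saturation puts `w` itself in `L`, and `x` is zero modulo `X`.
    obtain ⟨w, hw⟩ := exists_X_smul_eq (R := R) 1 (x : I → R⸨X⸩)
    rw [pow_one] at hw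
    have h2 : (PowerSeries.C r : R⟦X⟧) • w = y := by
      apply X_smul_injective (R := R)
      rw [smul_comm, ← hw]
      exact congrArg Subtype.val hy
    have hwL : w ∈ L := hsat r w hr.ne_zero (h2 ▸ y.2)
    exact toModX_eq_zero_iff.2 ⟨⟨w, hwL⟩, Subtype.ext hw⟩
  exact ⟨free_of_modX fun x hx => Subtype.ext <| X_smul_injective (R := R)
    ((congrArg Subtype.val hx).trans (smul_zero _).symm), hfin⟩

/-- The columns of `B` are a basis of `L`. They remain independent over `R⸨X⸩`, and they span
because `L` contains the standard lattice; hence there are as many of them as elements of `I` and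
`B` is invertible. -/
lemma exists_matrix_of_saturated [DecidableEq I] (L : Submodule R⟦X⟧ (I → R⸨X⸩))
    (hsat : ∀ (r : R) (x : I → R⸨X⸩), r ≠ 0 → (PowerSeries.C r : R⟦X⟧) • x ∈ L → x ∈ L)
    (m : ℕ) (hbd : ∀ x ∈ L, ∃ s : I → R⟦X⟧,
      (PowerSeries.X : R⟦X⟧) ^ m • x = fun i => algebraMap R⟦X⟧ R⸨X⸩ (s i))
    (hle : ∀ s : I → R⟦X⟧, (fun i => algebraMap R⟦X⟧ R⸨X⸩ (s i)) ∈ L) :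
    ∃ B : Matrix I I R⸨X⸩, IsUnit B.det ∧
      ∀ x, x ∈ L ↔ ∃ s : I → R⟦X⟧, x = B.mulVec fun i => algebraMap R⟦X⟧ R⸨X⸩ (s i) := by
  obtain ⟨_, _⟩ := free_of_saturated L hsat m hbd
  let b := Module.Free.chooseBasis R⟦X⟧ L
  have hli : LinearIndependent R⸨X⸩ (fun i => (b i : I → R⸨X⸩)) :=
    LinearIndependent.localization R⸨X⸩ (Submonoid.powers (PowerSeries.X : R⟦X⟧))
      (b.linearIndependent.map' L.subtype L.ker_subtype)
  have hspan : ∀ x ∈ L, x ∈ Submodule.span R⸨X⸩ (Set.range fun i => (b i : I → R⸨X⸩)) := by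
    intro x hx
    have h : x = ((∑ i, b.repr ⟨x, hx⟩ i • b i : L) : I → R⸨X⸩) :=
      (congrArg Subtype.val (b.sum_repr ⟨x, hx⟩)).symm
    rw [h, AddSubmonoidClass.coe_finsetSum]
    refine Submodule.sum_mem _ fun i _ => ?_
    rw [SetLike.val_smul, ← algebraMap_smul R⸨X⸩]
    exact Submodule.smul_mem _ _ (Submodule.subset_span ⟨i, rfl⟩)
  let c := Module.Basis.mk hli (by
    rintro x -
    rw [pi_eq_sum_univ x]
    refine Submodule.sum_mem _ fun i _ => Submodule.smul_mem _ _ (hspan _ ?_)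
    convert hle (Pi.single i 1) using 2 with j
    by_cases h : i = j
    · subst h; simp
    · simp [h, Ne.symm h])
  let e := c.indexEquiv (Pi.basisFun R⸨X⸩ I)
  let B := (Pi.basisFun R⸨X⸩ I).toMatrix (c.reindex e)
  have hB : ∀ s : I → R⟦X⟧, (B.mulVec fun i => algebraMap R⟦X⟧ R⸨X⸩ (s i)) =
      ((∑ j, s (e j) • b j : L) : I → R⸨X⸩) := by
    intro s
    ext1 i
    rw [AddSubmonoidClass.coe_finsetSum, Finset.sum_apply, Matrix.mulVec, dotProduct]
    rw [← e.sum_comp]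
    refine Finset.sum_congr rfl fun j _ => ?_
    simp [B, Module.Basis.toMatrix_apply, c, Algebra.smul_def, mul_comm]
  refine ⟨B, ?_, fun x => ⟨fun hx => ?_, ?_⟩⟩
  · rw [← Matrix.isUnit_iff_isUnit_det]
    have := (Pi.basisFun R⸨X⸩ I).invertibleToMatrix (c.reindex e)
    exact isUnit_of_invertible B
  · refine ⟨fun i => b.repr ⟨x, hx⟩ (e.symm i), ?_⟩
    rw [hB]
    simp only [Equiv.symm_apply_apply, b.sum_repr]
  · rintro ⟨s, rfl⟩
    rw [hB]
    exact Subtype.property _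

end Lattice

/-! ### The saturated span of a bounded matrix monoid. -/

section Core

variable {R : Type*} [CommRing R] {I : Type*}

/-- The `R⟦X⟧`-submodule of vectors `x` such that `r • x ∈ L` for some nonzero `r ∈ R`. -/
def saturation [IsDomain R] (L : Submodule R⟦X⟧ (I → R⸨X⸩)) : Submodule R⟦X⟧ (I → R⸨X⸩) where
  carrier := {x | ∃ r : R, r ≠ 0 ∧ (PowerSeries.C r : R⟦X⟧) • x ∈ L}
  zero_mem' := ⟨1, one_ne_zero, by simp⟩
  add_mem' := by
    rintro x y ⟨r, hr, hx⟩ ⟨r', hr', hy⟩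
    refine ⟨r' * r, mul_ne_zero hr' hr, ?_⟩
    rw [smul_add, map_mul, mul_smul _ _ x, mul_comm, mul_smul _ _ y]
    exact L.add_mem (L.smul_mem _ hx) (L.smul_mem _ hy)
  smul_mem' := by
    rintro c x ⟨r, hr, hx⟩
    exact ⟨r, hr, by rw [smul_comm]; exact L.smul_mem _ hx⟩

lemma laurentMap_comp_smul (f : R →+* R) (c : R⟦X⟧) (x : I → R⸨X⸩) :
    laurentMap f ∘ (c • x) = PowerSeries.map f c • (laurentMap f ∘ x) := by
  ext1 i
  change laurentMap f (c • x i) = PowerSeries.map f c • laurentMap f (x i)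
  simp only [Algebra.smul_def, map_mul, laurentMap_algebraMap]

variable [Fintype I]

lemma exists_matrix_eq_mul (B N : Matrix I I R⸨X⸩)
    (h : ∀ j, ∃ s : I → R⟦X⟧, (fun i => N i j) = B.mulVec fun i => algebraMap R⟦X⟧ R⸨X⸩ (s i)) :
    ∃ C : Matrix I I R⟦X⟧, N = B * C.map (algebraMap R⟦X⟧ R⸨X⸩) := by
  choose s hs using h
  exact ⟨Matrix.of fun i j => s j i, Matrix.ext fun i j => congrFun (hs j) i⟩

lemma algebraMap_comp_mulVec (T : Matrix I I R⟦X⟧) (s : I → R⟦X⟧) :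
    algebraMap R⟦X⟧ R⸨X⸩ ∘ T.mulVec s =
      (T.map (algebraMap R⟦X⟧ R⸨X⸩)).mulVec (algebraMap R⟦X⟧ R⸨X⸩ ∘ s) :=
  funext fun i => RingHom.map_mulVec _ T s i

/-- The `R⟦X⟧`-span of the images of the standard lattice under a set of matrices. -/
def latticeSpan (O : Set (Matrix I I R⸨X⸩)) : Submodule R⟦X⟧ (I → R⸨X⸩) :=
  Submodule.span R⟦X⟧ {x | ∃ A ∈ O, ∃ s : I → R⟦X⟧, x = A.mulVec (algebraMap R⟦X⟧ R⸨X⸩ ∘ s)}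

/-- The exponent `m` is uniform over `O`, so it survives arbitrary `R⟦X⟧`-combinations. -/
lemma latticeSpan_bounded {O : Set (Matrix I I R⸨X⸩)} {m : ℕ}
    (hbd : ∀ A ∈ O, ∃ A' : Matrix I I R⟦X⟧,
      (PowerSeries.X : R⟦X⟧) ^ m • A = A'.map (algebraMap R⟦X⟧ R⸨X⸩))
    {x : I → R⸨X⸩} (hx : x ∈ latticeSpan O) :
    ∃ s : I → R⟦X⟧, (PowerSeries.X : R⟦X⟧) ^ m • x = algebraMap R⟦X⟧ R⸨X⸩ ∘ s := by
  induction hx using Submodule.span_induction with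
  | mem x hx =>
    obtain ⟨A, hA, s, rfl⟩ := hx
    obtain ⟨A', hA'⟩ := hbd A hA
    exact ⟨A'.mulVec s, by rw [← Matrix.smul_mulVec, hA', algebraMap_comp_mulVec]⟩
  | zero => exact ⟨0, by ext1 i; simp⟩
  | add x y _ _ hx hy =>
    obtain ⟨s, hs⟩ := hx
    obtain ⟨s', hs'⟩ := hy
    exact ⟨s + s', by rw [smul_add, hs, hs']; ext1 i; simp⟩
  | smul c x _ hx =>
    obtain ⟨s, hs⟩ := hx
    refine ⟨c • s, ?_⟩
    rw [smul_comm, hs]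
    ext1 i
    change c • algebraMap R⟦X⟧ R⸨X⸩ (s i) = algebraMap R⟦X⟧ R⸨X⸩ (c * s i)
    rw [Algebra.smul_def, map_mul]

lemma mulVec_mem_latticeSpan [DecidableEq I] {O : Submonoid (Matrix I I R⸨X⸩)}
    {A : Matrix I I R⸨X⸩} (hA : A ∈ O)
    {x : I → R⸨X⸩} (hx : x ∈ latticeSpan (O : Set (Matrix I I R⸨X⸩))) :
    A.mulVec x ∈ latticeSpan (O : Set (Matrix I I R⸨X⸩)) := by
  induction hx using Submodule.span_induction with
  | mem x hx =>
    obtain ⟨A', hA', s, rfl⟩ := hx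
    exact Submodule.subset_span ⟨A * A', O.mul_mem hA hA', s, by rw [Matrix.mulVec_mulVec]⟩
  | zero => simp
  | add x y _ _ hx hy => rw [Matrix.mulVec_add]; exact Submodule.add_mem _ hx hy
  | smul c x _ hx => rw [Matrix.mulVec_smul]; exact Submodule.smul_mem _ _ hx

/-- The commutation relation moves the semilinear operator past `A` onto the standard lattice, which
it preserves because `T` is integral. -/
lemma semilinear_mem_latticeSpan (f : R →+* R) {T : Matrix I I R⟦X⟧} {O : Set (Matrix I I R⸨X⸩)}
    (hT : ∀ A ∈ O, T.map (algebraMap R⟦X⟧ R⸨X⸩) * A.map (laurentMap f) =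
      A * T.map (algebraMap R⟦X⟧ R⸨X⸩)) {x : I → R⸨X⸩} (hx : x ∈ latticeSpan O) :
    (T.map (algebraMap R⟦X⟧ R⸨X⸩)).mulVec (laurentMap f ∘ x) ∈ latticeSpan O := by
  induction hx using Submodule.span_induction with
  | mem x hx =>
    obtain ⟨A, hA, s, rfl⟩ := hx
    refine Submodule.subset_span ⟨A, hA, T.mulVec (PowerSeries.map f ∘ s), ?_⟩
    have h1 : laurentMap f ∘ (A.mulVec (algebraMap R⟦X⟧ R⸨X⸩ ∘ s)) =
        (A.map (laurentMap f)).mulVec (algebraMap R⟦X⟧ R⸨X⸩ ∘ (PowerSeries.map f ∘ s)) := by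
      ext1 i
      rw [Function.comp_apply, RingHom.map_mulVec]
      congr 1
      exact funext fun j => laurentMap_algebraMap f (s j)
    rw [h1, algebraMap_comp_mulVec, Matrix.mulVec_mulVec, Matrix.mulVec_mulVec, hT A hA]
  | zero =>
    have : laurentMap f ∘ (0 : I → R⸨X⸩) = 0 := funext fun i => map_zero _
    rw [this, Matrix.mulVec_zero]
    exact Submodule.zero_mem _
  | add x y _ _ hx hy =>
    have : laurentMap f ∘ (x + y) = laurentMap f ∘ x + laurentMap f ∘ y :=
      funext fun i => map_add _ _ _
    rw [this, Matrix.mulVec_add]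
    exact Submodule.add_mem _ hx hy
  | smul c x _ hx =>
    rw [laurentMap_comp_smul, Matrix.mulVec_smul]
    exact Submodule.smul_mem _ _ hx

/-- A bounded monoid of matrices over `R⟦X⟧[1/X]` commuting with a Frobenius-semilinear map
`T` over `R⟦X⟧` can be conjugated into `R⟦X⟧`-matrices, compatibly with `T`. -/
theorem exists_integral_conjugate [IsDomain R] [IsPrincipalIdealRing R] [DecidableEq I]
    (f : R →+* R) (hf : Function.Injective f)
    (T : Matrix I I R⟦X⟧) (O : Submonoid (Matrix I I R⸨X⸩))
    (hT : ∀ A ∈ O, T.map (algebraMap R⟦X⟧ R⸨X⸩) * A.map (laurentMap f) =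
      A * T.map (algebraMap R⟦X⟧ R⸨X⸩))
    (m : ℕ) (hbd : ∀ A ∈ O, ∃ A' : Matrix I I R⟦X⟧,
      (PowerSeries.X : R⟦X⟧) ^ m • A = A'.map (algebraMap R⟦X⟧ R⸨X⸩)) :
    ∃ (B : Matrix I I R⸨X⸩) (T' : Matrix I I R⟦X⟧) (w : R⟦X⟧ˣ), IsUnit B.det ∧
      T.map (algebraMap R⟦X⟧ R⸨X⸩) * B.map (laurentMap f) =
        B * T'.map (algebraMap R⟦X⟧ R⸨X⸩) ∧
      T'.det = w * T.det ∧
      ∀ A ∈ O, ∃ A' : Matrix I I R⟦X⟧, A * B = B * A'.map (algebraMap R⟦X⟧ R⸨X⸩) := by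
  let L := latticeSpan (O : Set (Matrix I I R⸨X⸩))
  have hsat : ∀ (r : R) (x : I → R⸨X⸩), r ≠ 0 →
      (PowerSeries.C r : R⟦X⟧) • x ∈ saturation L → x ∈ saturation L := by
    rintro r x hr ⟨r', hr', h⟩
    refine ⟨r' * r, mul_ne_zero hr' hr, ?_⟩
    rwa [map_mul, mul_smul]
  have hbd' : ∀ x ∈ saturation L, ∃ s : I → R⟦X⟧,
      (PowerSeries.X : R⟦X⟧) ^ m • x = fun i => algebraMap R⟦X⟧ R⸨X⸩ (s i) := by
    rintro x ⟨r, hr, h⟩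
    obtain ⟨s, hs⟩ := latticeSpan_bounded hbd h
    -- Saturating costs no further power of `X`: the constant `r` can be removed coordinate by
    -- coordinate.
    have : ∀ i, ∃ s' : R⟦X⟧,
        (PowerSeries.X : R⟦X⟧) ^ m • x i = algebraMap R⟦X⟧ R⸨X⸩ s' := by
      intro i
      refine exists_algebraMap_of_C_mul hr (s := s i) ?_
      rw [← Algebra.smul_def, smul_comm]
      exact congrFun hs i
    choose s' hs' using this
    exact ⟨s', funext hs'⟩
  have hle : ∀ s : I → R⟦X⟧, (fun i => algebraMap R⟦X⟧ R⸨X⸩ (s i)) ∈ saturation L := fun s =>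
    ⟨1, one_ne_zero, by
      rw [map_one, one_smul]
      exact Submodule.subset_span ⟨1, O.one_mem, s, by rw [Matrix.one_mulVec]; rfl⟩⟩
  obtain ⟨B, hBu, hB⟩ := exists_matrix_of_saturated (saturation L) hsat m hbd' hle
  have hBj : ∀ j, (fun i => B i j) ∈ saturation L := fun j => (hB _).2 ⟨Pi.single j 1, by
    have : (fun i => algebraMap R⟦X⟧ R⸨X⸩ ((Pi.single j 1 : I → R⟦X⟧) i)) = Pi.single j 1 := by
      ext1 i
      by_cases h : i = j
      · subst h; simp
      · simp [h]
    rw [this, Matrix.mulVec_single_one]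
    rfl⟩
  have hAL : ∀ A ∈ O, ∀ x ∈ saturation L, A.mulVec x ∈ saturation L := by
    rintro A hA x ⟨r, hr, h⟩
    exact ⟨r, hr, by rw [← Matrix.mulVec_smul]; exact mulVec_mem_latticeSpan hA h⟩
  have hTL : ∀ x ∈ saturation L,
      (T.map (algebraMap R⟦X⟧ R⸨X⸩)).mulVec (laurentMap f ∘ x) ∈ saturation L := by
    rintro x ⟨r, hr, h⟩
    -- By semilinearity the multiplier `r` turns into `f r`; injectivity of `f` keeps it nonzero.
    refine ⟨f r, (map_ne_zero_iff f hf).2 hr, ?_⟩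
    have := semilinear_mem_latticeSpan f hT h
    rwa [laurentMap_comp_smul, PowerSeries.map_C, Matrix.mulVec_smul] at this
  obtain ⟨T', hT'⟩ := exists_matrix_eq_mul B
    (T.map (algebraMap R⟦X⟧ R⸨X⸩) * B.map (laurentMap f)) fun j => (hB _).1 (hTL _ (hBj j))
  -- The unit `w` is `f(det B) / det B`, the factor by which the determinants of `T` and `T'`
  -- differ.
  obtain ⟨w, hw⟩ := exists_laurentMap_eq_mul_unit f hBu
  refine ⟨B, T', w, hBu, hT', ?_, fun A hA => exists_matrix_eq_mul B (A * B)
    fun j => (hB _).1 (hAL A hA _ (hBj j))⟩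
  apply algebraMap_laurent_injective
  have h := congrArg Matrix.det hT'
  have e1 : (T.map (algebraMap R⟦X⟧ R⸨X⸩)).det = algebraMap R⟦X⟧ R⸨X⸩ T.det :=
    (RingHom.map_det _ T).symm
  have e2 : (B.map (laurentMap f)).det = laurentMap f B.det := (RingHom.map_det _ B).symm
  have e3 : (T'.map (algebraMap R⟦X⟧ R⸨X⸩)).det = algebraMap R⟦X⟧ R⸨X⸩ T'.det :=
    (RingHom.map_det _ T').symm
  rw [Matrix.det_mul, Matrix.det_mul, e1, e2, e3, hw] at h
  refine hBu.mul_left_cancel ?_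
  rw [map_mul, ← h]
  ring

end Core

/-! ### Matrices of pullbacks and of scalar extensions. -/

section PullbackBasis

variable {S : Type*} [CommRing S] (σ : S →+* S) {M N I : Type*} [AddCommGroup M] [Module S M]
  [AddCommGroup N] [Module S N]

/-- The basis `1 ⊗ b i` of `σ^* M` attached to a basis `b` of `M`. -/
def pullbackBasis (b : Module.Basis I S M) : Module.Basis I S (Pullback σ M) :=
  let b' : Module.Basis I (Twist σ) (Pullback σ M) := Algebra.TensorProduct.basis (Twist σ) b
  b'.mapCoeffs (toTwist σ).symm fun _ _ => rfl

lemma pullbackBasis_apply (b : Module.Basis I S M) (i : I) :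
    pullbackBasis σ b i = pullbackMk σ (b i) := by
  exact (Module.Basis.mapCoeffs_apply _ (toTwist σ).symm (fun _ _ => rfl) i).trans
    (Algebra.TensorProduct.basis_apply b i)

variable [Fintype I]

lemma pullbackBasis_repr_mk (b : Module.Basis I S M) (x : M) (i : I) :
    (pullbackBasis σ b).repr (pullbackMk σ x) i = σ (b.repr x i) := by
  conv_lhs => rw [← b.sum_repr x]
  simp only [map_sum, LinearMap.map_smulₛₗ, ← pullbackBasis_apply]
  classical
  simp [Finsupp.single_apply]

variable [DecidableEq I]

lemma toMatrix_pullbackMap (b : Module.Basis I S M) (c : Module.Basis I S N) (f : M →ₗ[S] N) :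
    LinearMap.toMatrix (pullbackBasis σ b) (pullbackBasis σ c) (pullbackMap σ f) =
      (LinearMap.toMatrix b c f).map σ := by
  ext i j
  rw [LinearMap.toMatrix_apply, pullbackBasis_apply, pullbackMap_mk, pullbackBasis_repr_mk,
    Matrix.map_apply, LinearMap.toMatrix_apply]

end PullbackBasis

lemma exists_linearEquiv_toMatrix_eq {A V W I : Type*} [CommRing A] [AddCommGroup V] [Module A V]
    [AddCommGroup W] [Module A W] [Fintype I] [DecidableEq I] (b : Module.Basis I A V)
    (c : Module.Basis I A W) {P : Matrix I I A} (hP : IsUnit P.det) :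
    ∃ e : V ≃ₗ[A] W, LinearMap.toMatrix b c (e : V →ₗ[A] W) = P := by
  have h : IsUnit (LinearMap.toMatrix b c (Matrix.toLin b c P)).det := by
    rwa [LinearMap.toMatrix_toLin]
  exact ⟨LinearEquiv.ofIsUnitDet h, by rw [LinearEquiv.coe_ofIsUnitDet, LinearMap.toMatrix_toLin]⟩

section ExtendScalarsMatrix

variable {S P B : Type*} [CommRing S] [CommRing P] [CommRing B] [Algebra S P] [Algebra S B]
  {M N I : Type*} [AddCommGroup M] [Module S M] [AddCommGroup N] [Module S N]

lemma basis_repr_rTensor (φ : P →ₐ[S] B) (c : Module.Basis I S N) (x : P ⊗[S] N) (i : I) :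
    (Algebra.TensorProduct.basis B c).repr (φ.toLinearMap.rTensor N x) i =
      φ ((Algebra.TensorProduct.basis P c).repr x i) := by
  induction x with
  | zero => simp
  | tmul p n => simp [Algebra.TensorProduct.basis_repr_tmul]
  | add x y hx hy => simp only [map_add, Finsupp.add_apply, hx, hy]

lemma toMatrix_extendScalars [Fintype I] [DecidableEq I] (φ : P →ₐ[S] B) (b : Module.Basis I S M)
    (c : Module.Basis I S N) (g : P ⊗[S] M →ₗ[P] P ⊗[S] N) :
    LinearMap.toMatrix (Algebra.TensorProduct.basis B b) (Algebra.TensorProduct.basis B c)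
        (extendScalars φ g) =
      (LinearMap.toMatrix (Algebra.TensorProduct.basis P b) (Algebra.TensorProduct.basis P c)
        g).map φ := by
  ext i j
  rw [LinearMap.toMatrix_apply, Algebra.TensorProduct.basis_apply, extendScalars_one_tmul,
    basis_repr_rTensor, Matrix.map_apply, LinearMap.toMatrix_apply,
    Algebra.TensorProduct.basis_apply]

end ExtendScalarsMatrix

section LaurentMatrix

variable (Fv : Type*) {R : Type*} [Field Fv] [Fintype Fv] [CommRing R] [Algebra Fv R]
  {M N I : Type*} [AddCommGroup M] [Module R⟦X⟧ M] [AddCommGroup N] [Module R⟦X⟧ N] [Fintype I]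

lemma basis_repr_pullbackMkLaurent (c : Module.Basis I R⟦X⟧ N) (x : R⸨X⸩ ⊗[R⟦X⟧] N) (i : I) :
    (Algebra.TensorProduct.basis R⸨X⸩ (pullbackBasis (sigmaHat Fv R) c)).repr
        (pullbackMkLaurent Fv x) i =
      sigmaHatLaurent Fv R ((Algebra.TensorProduct.basis R⸨X⸩ c).repr x i) := by
  induction x with
  | zero => simp
  | tmul p n =>
    have h : pullbackMkLaurent Fv (p ⊗ₜ[R⟦X⟧] n) =
      sigmaHatLaurent Fv R p ⊗ₜ pullbackMk (sigmaHat Fv R) n := rfl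
    rw [h]
    simp only [Algebra.TensorProduct.basis_repr_tmul, Finsupp.smul_apply, Finsupp.mapRange_apply,
      pullbackBasis_repr_mk, smul_eq_mul, map_mul]
    congr 1
    exact (laurentMap_algebraMap _ _).symm
  | add x y hx hy => simp only [map_add, Finsupp.add_apply, hx, hy]

lemma toMatrix_pullbackMapLaurent [DecidableEq I] (b : Module.Basis I R⟦X⟧ M)
    (c : Module.Basis I R⟦X⟧ N) (f : R⸨X⸩ ⊗[R⟦X⟧] M →ₗ[R⸨X⸩] R⸨X⸩ ⊗[R⟦X⟧] N) :
    LinearMap.toMatrix (Algebra.TensorProduct.basis R⸨X⸩ (pullbackBasis (sigmaHat Fv R) b))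
        (Algebra.TensorProduct.basis R⸨X⸩ (pullbackBasis (sigmaHat Fv R) c))
        (pullbackMapLaurent Fv f) =
      (LinearMap.toMatrix (Algebra.TensorProduct.basis R⸨X⸩ b)
        (Algebra.TensorProduct.basis R⸨X⸩ c) f).map (sigmaHatLaurent Fv R) := by
  ext1 i j
  rw [LinearMap.toMatrix_apply, Algebra.TensorProduct.basis_apply, pullbackBasis_apply,
    pullbackMapLaurent_one_tmul, basis_repr_pullbackMkLaurent, Matrix.map_apply,
    LinearMap.toMatrix_apply, Algebra.TensorProduct.basis_apply]

end LaurentMatrix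

end LocSht

/-! ### Local shtukas in terms of matrices. -/

namespace LocalShtuka

open LocSht

variable {Fv : Type u} {R : Type v} [Field Fv] [Fintype Fv] [CommRing R]
  [Algebra Fv R] {ζ : R}
  {I : Type*} [Fintype I] [DecidableEq I]

/-- The matrix of `τ` with respect to a basis of the underlying module. -/
def tauMatrix (M : LocalShtuka Fv ζ) (b : Module.Basis I R⟦X⟧ M.carrier) :
    Matrix I I (AwayZeta ζ) :=
  LinearMap.toMatrix (Algebra.TensorProduct.basis _ (pullbackBasis (sigmaHat Fv R) b))
    (Algebra.TensorProduct.basis _ b) (M.τ : _ →ₗ[AwayZeta ζ] _)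

/-- The matrix of a linear map `M[1/z] → N[1/z]` with respect to bases of `M` and `N`. -/
abbrev laurentMatrix {M N : LocalShtuka Fv ζ} (b : Module.Basis I R⟦X⟧ M.carrier)
    (c : Module.Basis I R⟦X⟧ N.carrier) :
    (M.Laurent →ₗ[R⸨X⸩] N.Laurent) ≃ₗ[R⸨X⸩] Matrix I I R⸨X⸩ :=
  LinearMap.toMatrix (Algebra.TensorProduct.basis R⸨X⸩ b) (Algebra.TensorProduct.basis R⸨X⸩ c)

lemma isUnit_det_tauMatrix (M : LocalShtuka Fv ζ) (b : Module.Basis I R⟦X⟧ M.carrier) :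
    IsUnit (M.tauMatrix b).det :=
  LinearEquiv.isUnit_det M.τ _ _

lemma isQuasiMorphism_iff_matrix {M N : LocalShtuka Fv ζ} (b : Module.Basis I R⟦X⟧ M.carrier)
    (c : Module.Basis I R⟦X⟧ N.carrier) (f : M.Laurent →ₗ[R⸨X⸩] N.Laurent) :
    IsQuasiMorphism M N f ↔
      (N.tauMatrix c).map (zetaToBoth ζ) *
          ((laurentMatrix b c f).map (sigmaHatLaurent Fv R)).map (laurentToBoth ζ) =
        (laurentMatrix b c f).map (laurentToBoth ζ) * (M.tauMatrix b).map (zetaToBoth ζ) := by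
  unfold IsQuasiMorphism
  rw [← (LinearMap.toMatrix
      (Algebra.TensorProduct.basis (AwayBoth ζ) (pullbackBasis (sigmaHat Fv R) b))
      (Algebra.TensorProduct.basis (AwayBoth ζ) c)).injective.eq_iff,
    LinearMap.toMatrix_comp _
      (Algebra.TensorProduct.basis (AwayBoth ζ) (pullbackBasis (sigmaHat Fv R) c)) _,
    LinearMap.toMatrix_comp _ (Algebra.TensorProduct.basis (AwayBoth ζ) b) _,
    toMatrix_extendScalars, toMatrix_extendScalars, toMatrix_extendScalars,
    toMatrix_extendScalars, toMatrix_pullbackMapLaurent]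
  rfl

lemma isMorphism_iff_matrix {M N : LocalShtuka Fv ζ} (b : Module.Basis I R⟦X⟧ M.carrier)
    (c : Module.Basis I R⟦X⟧ N.carrier) (f : M.carrier →ₗ[R⟦X⟧] N.carrier) :
    IsMorphism M N f ↔
      N.tauMatrix c * ((LinearMap.toMatrix b c f).map (sigmaHat Fv R)).map
          (algebraMap R⟦X⟧ (AwayZeta ζ)) =
        (LinearMap.toMatrix b c f).map (algebraMap R⟦X⟧ (AwayZeta ζ)) * M.tauMatrix b := by
  unfold IsMorphism
  rw [← (LinearMap.toMatrix
      (Algebra.TensorProduct.basis (AwayZeta ζ) (pullbackBasis (sigmaHat Fv R) b))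
      (Algebra.TensorProduct.basis (AwayZeta ζ) c)).injective.eq_iff,
    LinearMap.toMatrix_comp _
      (Algebra.TensorProduct.basis (AwayZeta ζ) (pullbackBasis (sigmaHat Fv R) c)) _,
    LinearMap.toMatrix_comp _ (Algebra.TensorProduct.basis (AwayZeta ζ) b) _,
    LinearMap.toMatrix_baseChange, LinearMap.toMatrix_baseChange, toMatrix_pullbackMap]
  rfl

lemma isUnit_algebraMap_awayZeta :
    IsUnit (algebraMap R⟦X⟧ (AwayZeta ζ) (PowerSeries.X - PowerSeries.C ζ)) :=
  IsLocalization.Away.algebraMap_isUnit _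

/-- The matrix of `τ` becomes integral after multiplication by a power of `z - ζ`. -/
lemma exists_pow_smul_tauMatrix (M : LocalShtuka Fv ζ) (b : Module.Basis I R⟦X⟧ M.carrier) :
    ∃ (n : ℕ) (T : Matrix I I R⟦X⟧),
      algebraMap R⟦X⟧ (AwayZeta ζ) (PowerSeries.X - PowerSeries.C ζ) ^ n • M.tauMatrix b =
        T.map (algebraMap R⟦X⟧ (AwayZeta ζ)) := by
  obtain ⟨⟨_, n, rfl⟩, h⟩ := IsLocalization.exist_integer_multiples_of_finite
    (Submonoid.powers (PowerSeries.X - PowerSeries.C ζ : R⟦X⟧))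
    (fun p : I × I => M.tauMatrix b p.1 p.2)
  choose T hT using h
  refine ⟨n, Matrix.of fun i j => T (i, j), ?_⟩
  ext1 i j
  have := hT (i, j)
  simp only [Algebra.smul_def, map_pow] at this
  exact this.symm

/-- The local shtuka with the same underlying module and another isomorphism `τ`. -/
def withTau (M : LocalShtuka.{u, v, w} Fv ζ)
    (e : AwayZeta ζ ⊗[R⟦X⟧] Pullback (sigmaHat Fv R) M.carrier ≃ₗ[AwayZeta ζ]
      AwayZeta ζ ⊗[R⟦X⟧] M.carrier) : LocalShtuka.{u, v, w} Fv ζ where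
  carrier := M.carrier
  τ := e

lemma tauMatrix_withTau (M : LocalShtuka.{u, v, w} Fv ζ) (b : Module.Basis I R⟦X⟧ M.carrier)
    (e : AwayZeta ζ ⊗[R⟦X⟧] Pullback (sigmaHat Fv R) M.carrier ≃ₗ[AwayZeta ζ]
      AwayZeta ζ ⊗[R⟦X⟧] M.carrier) :
    (M.withTau e).tauMatrix b =
      LinearMap.toMatrix (Algebra.TensorProduct.basis _ (pullbackBasis (sigmaHat Fv R) b))
        (Algebra.TensorProduct.basis _ b) (e : _ →ₗ[AwayZeta ζ] _) := rfl

/-- An integral matrix whose determinant is a unit after inverting `z - ζ` defines, up to a power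
of `z - ζ`, a local shtuka. -/
lemma exists_tauMatrix_eq (M : LocalShtuka.{u, v, w} Fv ζ) (b : Module.Basis I R⟦X⟧ M.carrier)
    (n : ℕ) (T : Matrix I I R⟦X⟧) (hT : IsUnit (algebraMap R⟦X⟧ (AwayZeta ζ) T.det)) :
    ∃ (N : LocalShtuka.{u, v, w} Fv ζ) (c : Module.Basis I R⟦X⟧ N.carrier),
      algebraMap R⟦X⟧ (AwayZeta ζ) (PowerSeries.X - PowerSeries.C ζ) ^ n • N.tauMatrix c =
        T.map (algebraMap R⟦X⟧ (AwayZeta ζ)) := by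
  obtain ⟨t, ht⟩ := (isUnit_algebraMap_awayZeta (ζ := ζ)).pow n
  obtain ⟨e, he⟩ := exists_linearEquiv_toMatrix_eq
    (Algebra.TensorProduct.basis (AwayZeta ζ) (pullbackBasis (sigmaHat Fv R) b))
    (Algebra.TensorProduct.basis (AwayZeta ζ) b)
    (P := (↑t⁻¹ : AwayZeta ζ) • T.map (algebraMap R⟦X⟧ (AwayZeta ζ))) (by
      rw [Matrix.det_smul]
      refine ((Units.isUnit _).pow _).mul ?_
      rwa [← RingHom.mapMatrix_apply, ← RingHom.map_det])
  -- The module and basis of `M` are reused: up to isomorphism only the matrix of `τ` matters.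
  refine ⟨M.withTau e, b, ?_⟩
  rw [tauMatrix_withTau, he, ← ht, smul_smul, Units.mul_inv, one_smul]

end LocalShtuka

/-! ### Injectivity of Frobenius and of the localization maps. -/

namespace LocSht

lemma frob_injective (Fv R : Type*) [Field Fv] [Fintype Fv] [CommRing R] [IsDomain R]
    [Algebra Fv R] : Function.Injective (frob Fv R) := by
  rw [injective_iff_map_eq_zero]
  intro a ha
  exact eq_zero_of_pow_eq_zero (n := Fintype.card Fv) (by simpa using ha)

lemma map_matrix_mul {I A B : Type*} [Fintype I] [CommRing A] [CommRing B] (f : A →+* B)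
    (P Q : Matrix I I A) : (P * Q).map f = P.map f * Q.map f := Matrix.map_mul

variable {R : Type*} [CommRing R] [IsDomain R] (ζ : R)

lemma X_sub_C_ne_zero : (PowerSeries.X - PowerSeries.C ζ : R⟦X⟧) ≠ 0 := fun h => by
  simpa [PowerSeries.coeff_C] using congrArg (PowerSeries.coeff 1) h

lemma laurentToBoth_injective : Function.Injective (laurentToBoth ζ) := by
  refine IsLocalization.injective (M := Submonoid.powers
    (algebraMap R⟦X⟧ R⸨X⸩ (PowerSeries.X - PowerSeries.C ζ))) _
    (powers_le_nonZeroDivisors_of_noZeroDivisors ?_)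
  rw [map_ne_zero_iff _ algebraMap_laurent_injective]
  exact X_sub_C_ne_zero ζ

lemma algebraMap_awayZeta_injective :
    Function.Injective (algebraMap R⟦X⟧ (AwayZeta ζ)) :=
  IsLocalization.injective (M := Submonoid.powers (PowerSeries.X - PowerSeries.C ζ : R⟦X⟧)) _
    (powers_le_nonZeroDivisors_of_noZeroDivisors (X_sub_C_ne_zero ζ))

end LocSht

/-! ### Integral form of the Frobenius equations and transport by `B`. -/

namespace LocalShtuka

open LocSht

variable {Fv : Type u} {R : Type v} [Field Fv] [Fintype Fv] [CommRing R] [IsDomain R]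
  [Algebra Fv R] {ζ : R} {I : Type*} [Fintype I] [DecidableEq I]

/-- The same unit `(z - ζ) ^ n` clears denominators for `M` and `N`, so it cancels from the
equation. Injectivity of the localization then brings the equation back to `R⸨X⸩`, where `B` lives.
-/
lemma isQuasiMorphism_iff_integral {M N : LocalShtuka Fv ζ} {b : Module.Basis I R⟦X⟧ M.carrier}
    {c : Module.Basis I R⟦X⟧ N.carrier} {n : ℕ} {T T' : Matrix I I R⟦X⟧}
    (hT : algebraMap R⟦X⟧ (AwayZeta ζ) (PowerSeries.X - PowerSeries.C ζ) ^ n • M.tauMatrix b =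
      T.map (algebraMap R⟦X⟧ (AwayZeta ζ)))
    (hT' : algebraMap R⟦X⟧ (AwayZeta ζ) (PowerSeries.X - PowerSeries.C ζ) ^ n • N.tauMatrix c =
      T'.map (algebraMap R⟦X⟧ (AwayZeta ζ)))
    (f : M.Laurent →ₗ[R⸨X⸩] N.Laurent) :
    IsQuasiMorphism M N f ↔
      T'.map (algebraMap R⟦X⟧ R⸨X⸩) * (laurentMatrix b c f).map (laurentMap (frob Fv R)) =
        laurentMatrix b c f * T.map (algebraMap R⟦X⟧ R⸨X⸩) := by
  have key : ∀ {X T : Matrix I I _},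
      algebraMap R⟦X⟧ (AwayZeta ζ) (PowerSeries.X - PowerSeries.C ζ) ^ n • X =
        T.map (algebraMap R⟦X⟧ (AwayZeta ζ)) →
      zetaToBoth ζ (algebraMap R⟦X⟧ (AwayZeta ζ) (PowerSeries.X - PowerSeries.C ζ) ^ n) •
        X.map (zetaToBoth ζ) = (T.map (algebraMap R⟦X⟧ R⸨X⸩)).map (laurentToBoth ζ) := by
    intro X T h
    ext1 i j
    have h1 := congrArg (zetaToBoth ζ) (congrFun (congrFun h i) j)
    rw [Matrix.smul_apply, smul_eq_mul, map_mul, Matrix.map_apply, AlgHom.commutes] at h1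
    rw [Matrix.smul_apply, smul_eq_mul, Matrix.map_apply, h1, Matrix.map_apply, Matrix.map_apply,
      AlgHom.commutes]
  have hu : IsUnit (zetaToBoth ζ
      (algebraMap R⟦X⟧ (AwayZeta ζ) (PowerSeries.X - PowerSeries.C ζ) ^ n)) :=
    (isUnit_algebraMap_awayZeta.pow n).map _
  rw [isQuasiMorphism_iff_matrix b c, ← hu.smul_left_cancel, ← Matrix.smul_mul, ← Matrix.mul_smul,
    key hT, key hT']
  have e : ∀ P Q : Matrix I I R⸨X⸩, P.map (laurentToBoth ζ) * Q.map (laurentToBoth ζ) =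
      (P * Q).map (laurentToBoth ζ) := fun P Q =>
    (map_matrix_mul (laurentToBoth ζ : R⸨X⸩ →+* AwayBoth ζ) P Q).symm
  rw [e, e, (Matrix.map_injective (laurentToBoth_injective ζ)).eq_iff]
  rfl

lemma isMorphism_iff_integral {M N : LocalShtuka Fv ζ} {b : Module.Basis I R⟦X⟧ M.carrier}
    {c : Module.Basis I R⟦X⟧ N.carrier} {n : ℕ} {T T' : Matrix I I R⟦X⟧}
    (hT : algebraMap R⟦X⟧ (AwayZeta ζ) (PowerSeries.X - PowerSeries.C ζ) ^ n • M.tauMatrix b =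
      T.map (algebraMap R⟦X⟧ (AwayZeta ζ)))
    (hT' : algebraMap R⟦X⟧ (AwayZeta ζ) (PowerSeries.X - PowerSeries.C ζ) ^ n • N.tauMatrix c =
      T'.map (algebraMap R⟦X⟧ (AwayZeta ζ)))
    (f : M.carrier →ₗ[R⟦X⟧] N.carrier) :
    IsMorphism M N f ↔
      T' * (LinearMap.toMatrix b c f).map (PowerSeries.map (frob Fv R)) =
        LinearMap.toMatrix b c f * T := by
  rw [isMorphism_iff_matrix b c,
    ← ((isUnit_algebraMap_awayZeta (ζ := ζ)).pow n).smul_left_cancel,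
    ← Matrix.smul_mul, ← Matrix.mul_smul, hT, hT', ← map_matrix_mul (algebraMap R⟦X⟧ (AwayZeta ζ)),
    ← map_matrix_mul (algebraMap R⟦X⟧ (AwayZeta ζ)),
    (Matrix.map_injective (algebraMap_awayZeta_injective ζ)).eq_iff]
  rfl

omit [IsDomain R] in
lemma coe_smul_qEnd (M : LocalShtuka Fv ζ) {E : Type*} [CommRing E] [Algebra Fv⸨X⸩ E]
    [Algebra Fv⟦X⟧ E] [IsScalarTower Fv⟦X⟧ Fv⸨X⸩ E] (φ : E →ₐ[Fv⸨X⸩] M.QEnd) (c : Fv⟦X⟧) (x : E) :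
    (φ (c • x) : Module.End R⸨X⸩ M.Laurent) =
      algebraMap R⟦X⟧ R⸨X⸩ (constPower Fv R c) • (φ x : Module.End R⸨X⸩ M.Laurent) := by
  rw [← algebraMap_smul Fv⸨X⸩, map_smul, Algebra.smul_def]
  have h : constLaurent Fv R (algebraMap Fv⟦X⟧ Fv⸨X⸩ c) =
    algebraMap R⟦X⟧ R⸨X⸩ (constPower Fv R c) := laurentMap_algebraMap _ _
  rw [← h, Algebra.smul_def]
  rfl

omit [IsDomain R] in
/-- A finitely generated `A_v`-module of quasi-endomorphisms is bounded. -/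
lemma exists_X_pow_smul_laurentMatrix_integral (M : LocalShtuka Fv ζ)
    (b : Module.Basis I R⟦X⟧ M.carrier)
    {E : Type*} [CommRing E] [Algebra Fv⸨X⸩ E] [Algebra Fv⟦X⟧ E] [IsScalarTower Fv⟦X⟧ Fv⸨X⸩ E]
    (φ : E →ₐ[Fv⸨X⸩] M.QEnd) (N : Submodule Fv⟦X⟧ E) (hN : N.FG) :
    ∃ m : ℕ, ∀ a ∈ N, ∃ A : Matrix I I R⟦X⟧,
      (PowerSeries.X : R⟦X⟧) ^ m • laurentMatrix b b (φ a : Module.End R⸨X⸩ M.Laurent) =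
        A.map (algebraMap R⟦X⟧ R⸨X⸩) := by
  induction N, hN using Submodule.fg_induction with
  | singleton x =>
    obtain ⟨⟨_, m, rfl⟩, h⟩ := IsLocalization.exist_integer_multiples_of_finite
      (Submonoid.powers (PowerSeries.X : R⟦X⟧))
      (fun p : I × I => laurentMatrix b b (φ x : Module.End R⸨X⸩ M.Laurent) p.1 p.2)
    choose A hA using h
    refine ⟨m, fun a ha => ?_⟩
    obtain ⟨c, rfl⟩ := Submodule.mem_span_singleton.1 ha
    -- Multiples by `Fv⟦X⟧` have integral coefficients, so the denominators of the generator
    -- suffice.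
    refine ⟨Matrix.of fun i j => constPower Fv R c * A (i, j), ?_⟩
    rw [coe_smul_qEnd, map_smul]
    ext1 i j
    rw [Matrix.map_apply, Matrix.of_apply, map_mul, hA (i, j), Matrix.smul_apply,
      Matrix.smul_apply, smul_eq_mul, mul_smul_comm]
  | sup N₁ N₂ _ _ h₁ h₂ =>
    obtain ⟨m₁, h₁⟩ := h₁
    obtain ⟨m₂, h₂⟩ := h₂
    refine ⟨m₁ + m₂, fun a ha => ?_⟩
    obtain ⟨a₁, ha₁, a₂, ha₂, rfl⟩ := Submodule.mem_sup.1 ha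
    obtain ⟨A₁, hA₁⟩ := h₁ a₁ ha₁
    obtain ⟨A₂, hA₂⟩ := h₂ a₂ ha₂
    refine ⟨(PowerSeries.X : R⟦X⟧) ^ m₂ • A₁ + (PowerSeries.X : R⟦X⟧) ^ m₁ • A₂, ?_⟩
    have e : ∀ (s : R⟦X⟧) (A : Matrix I I R⟦X⟧), (s • A).map (algebraMap R⟦X⟧ R⸨X⸩) =
        s • A.map (algebraMap R⟦X⟧ R⸨X⸩) := fun s A =>
      Matrix.ext fun i j => by
        rw [Matrix.map_apply, Matrix.smul_apply, Matrix.smul_apply, Matrix.map_apply, smul_eq_mul,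
          map_mul, Algebra.smul_def]
    rw [Matrix.map_add _ (map_add _), e, e, ← hA₁, ← hA₂, smul_smul, smul_smul,
      ← pow_add, ← pow_add, add_comm m₂, ← smul_add, map_add, Subring.coe_add, map_add]

omit [IsDomain R] in
-- Conjugation by `B` determines the integral matrix; this uniqueness later makes an elementwise
-- choice of matrices a ring homomorphism.
lemma eq_of_mul_map_eq {B : Matrix I I R⸨X⸩} (hB : IsUnit B.det) {P Q : Matrix I I R⟦X⟧}
    (h : B * P.map (algebraMap R⟦X⟧ R⸨X⸩) = B * Q.map (algebraMap R⟦X⟧ R⸨X⸩)) : P = Q :=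
  Matrix.map_injective algebraMap_laurent_injective
    (((Matrix.isUnit_iff_isUnit_det B).2 hB).mul_left_cancel h)

/-- A matrix `B` with `T σ̂(B) = B T'` defines a quasi-isogeny with matrix `B⁻¹`. -/
lemma exists_quasiIsogeny {M N : LocalShtuka Fv ζ} {b : Module.Basis I R⟦X⟧ M.carrier}
    {c : Module.Basis I R⟦X⟧ N.carrier} {n : ℕ} {T T' : Matrix I I R⟦X⟧}
    (hT : algebraMap R⟦X⟧ (AwayZeta ζ) (PowerSeries.X - PowerSeries.C ζ) ^ n • M.tauMatrix b =
      T.map (algebraMap R⟦X⟧ (AwayZeta ζ)))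
    (hT' : algebraMap R⟦X⟧ (AwayZeta ζ) (PowerSeries.X - PowerSeries.C ζ) ^ n • N.tauMatrix c =
      T'.map (algebraMap R⟦X⟧ (AwayZeta ζ)))
    {B : Matrix I I R⸨X⸩} (hB : IsUnit B.det)
    (hBT : T.map (algebraMap R⟦X⟧ R⸨X⸩) * B.map (laurentMap (frob Fv R)) =
      B * T'.map (algebraMap R⟦X⟧ R⸨X⸩)) :
    ∃ f : QuasiIsogeny M N,
      laurentMatrix b c (f.toLinearEquiv : M.Laurent →ₗ[R⸨X⸩] N.Laurent) = B⁻¹ := by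
  have hB1 : B * B⁻¹ = 1 := Matrix.mul_nonsing_inv B hB
  have hB2 : B⁻¹ * B = 1 := Matrix.nonsing_inv_mul B hB
  have hcancel : ∀ {P Q : Matrix I I R⸨X⸩}, B * P = B * Q → P = Q := fun {P Q} h => by
    rw [← one_mul P, ← one_mul Q, ← hB2, mul_assoc, h, mul_assoc]
  obtain ⟨e, hf⟩ := exists_linearEquiv_toMatrix_eq (Algebra.TensorProduct.basis R⸨X⸩ b)
    (Algebra.TensorProduct.basis R⸨X⸩ c) (P := B⁻¹) (Matrix.isUnit_nonsing_inv_det_iff.2 hB)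
  have hσ : B.map (laurentMap (frob Fv R)) * B⁻¹.map (laurentMap (frob Fv R)) = 1 := by
    rw [← map_matrix_mul, hB1, Matrix.map_one _ (map_zero _) (map_one _)]
  refine ⟨⟨e, ?_⟩, hf⟩
  rw [isQuasiMorphism_iff_integral hT hT', hf]
  -- After multiplication by `B`, the left side becomes `T σ̂(B) σ̂(B⁻¹) = T`.
  apply hcancel
  rw [← mul_assoc, ← hBT, mul_assoc, hσ, mul_one, ← mul_assoc, hB1, one_mul]

/-- An integral matrix conjugate to the matrix of a quasi-morphism is that of a morphism. -/
lemma isMorphism_toLin_of_conjugate {M N : LocalShtuka Fv ζ} {b : Module.Basis I R⟦X⟧ M.carrier}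
    {c : Module.Basis I R⟦X⟧ N.carrier} {n : ℕ} {T T' : Matrix I I R⟦X⟧}
    (hT : algebraMap R⟦X⟧ (AwayZeta ζ) (PowerSeries.X - PowerSeries.C ζ) ^ n • M.tauMatrix b =
      T.map (algebraMap R⟦X⟧ (AwayZeta ζ)))
    (hT' : algebraMap R⟦X⟧ (AwayZeta ζ) (PowerSeries.X - PowerSeries.C ζ) ^ n • N.tauMatrix c =
      T'.map (algebraMap R⟦X⟧ (AwayZeta ζ)))
    {B : Matrix I I R⸨X⸩} (hB : IsUnit B.det)
    (hBT : T.map (algebraMap R⟦X⟧ R⸨X⸩) * B.map (laurentMap (frob Fv R)) =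
      B * T'.map (algebraMap R⟦X⟧ R⸨X⸩))
    {g : M.Laurent →ₗ[R⸨X⸩] M.Laurent} (hg : IsQuasiMorphism M M g) {A : Matrix I I R⟦X⟧}
    (hA : laurentMatrix b b g * B = B * A.map (algebraMap R⟦X⟧ R⸨X⸩)) :
    IsMorphism N N (Matrix.toLin c c A) := by
  have hgT : T.map (algebraMap R⟦X⟧ R⸨X⸩) *
      (laurentMatrix b b g).map (laurentMap (frob Fv R)) =
      laurentMatrix b b g * T.map (algebraMap R⟦X⟧ R⸨X⸩) :=
    (isQuasiMorphism_iff_integral hT hT g).1 hg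
  rw [isMorphism_iff_integral hT' hT', LinearMap.toMatrix_toLin]
  apply eq_of_mul_map_eq hB
  have e : ((A).map (PowerSeries.map (frob Fv R))).map (algebraMap R⟦X⟧ R⸨X⸩) =
        ((A).map (algebraMap R⟦X⟧ R⸨X⸩)).map (laurentMap (frob Fv R)) :=
      Matrix.ext fun i j => (laurentMap_algebraMap (frob Fv R) (A i j)).symm
  -- With `G` the matrix of `g`: `B T' σ̂(A) = T σ̂(B A) = T σ̂(G B) = G T σ̂(B) = G B T' = B A T'`.
  rw [map_matrix_mul, map_matrix_mul, e, ← mul_assoc, ← hBT, mul_assoc, ← map_matrix_mul,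
      ← hA, map_matrix_mul, ← mul_assoc, hgT, mul_assoc, hBT, ← mul_assoc, hA, mul_assoc]

/-- A subalgebra of quasi-endomorphisms whose matrices are conjugate to integral ones acts by
endomorphisms. -/
lemma exists_algHom_of_conjugate {M N : LocalShtuka Fv ζ} {b : Module.Basis I R⟦X⟧ M.carrier}
    {c : Module.Basis I R⟦X⟧ N.carrier} {n : ℕ} {T T' : Matrix I I R⟦X⟧}
    (hT : algebraMap R⟦X⟧ (AwayZeta ζ) (PowerSeries.X - PowerSeries.C ζ) ^ n • M.tauMatrix b =
      T.map (algebraMap R⟦X⟧ (AwayZeta ζ)))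
    (hT' : algebraMap R⟦X⟧ (AwayZeta ζ) (PowerSeries.X - PowerSeries.C ζ) ^ n • N.tauMatrix c =
      T'.map (algebraMap R⟦X⟧ (AwayZeta ζ)))
    {B : Matrix I I R⸨X⸩} (hB : IsUnit B.det)
    (hBT : T.map (algebraMap R⟦X⟧ R⸨X⸩) * B.map (laurentMap (frob Fv R)) =
      B * T'.map (algebraMap R⟦X⟧ R⸨X⸩))
    {E : Type*} [CommRing E] [Algebra Fv⸨X⸩ E] [Algebra Fv⟦X⟧ E] [IsScalarTower Fv⟦X⟧ Fv⸨X⸩ E]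
    (φ : E →ₐ[Fv⸨X⸩] M.QEnd) (O : Subalgebra Fv⟦X⟧ E)
    (hO : ∀ a ∈ O, ∃ A : Matrix I I R⟦X⟧,
      laurentMatrix b b (φ a : Module.End R⸨X⸩ M.Laurent) * B =
        B * A.map (algebraMap R⟦X⟧ R⸨X⸩)) :
    ∃ j : O →ₐ[Fv⟦X⟧] N.End, ∀ a : O,
      laurentMatrix b b (φ (a : E) : Module.End R⸨X⸩ M.Laurent) * B =
        B * (LinearMap.toMatrix c c (j a : Module.End R⟦X⟧ N.carrier)).map
          (algebraMap R⟦X⟧ R⸨X⸩) := by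
  have hinj {P Q : Matrix I I R⟦X⟧} := eq_of_mul_map_eq hB (P := P) (Q := Q)
  -- The choice is arbitrary for each element, but `hinj` leaves only one possible value on `O`, so
  -- every algebraic identity is inherited from `φ`.
  choose! J hJ using hO
  have hmul : ∀ g h : Module.End R⸨X⸩ M.Laurent,
      laurentMatrix b b (g * h) = laurentMatrix b b g * laurentMatrix b b h :=
    LinearMap.toMatrix_mul _
  have hone : laurentMatrix b b (1 : Module.End R⸨X⸩ M.Laurent) = 1 := LinearMap.toMatrix_one _
  have J_one : J 1 = 1 := hinj <| by
    rw [← hJ 1 O.one_mem, map_one, Subring.coe_one, hone,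
      Matrix.map_one _ (map_zero _) (map_one _), one_mul, mul_one]
  have J_mul : ∀ x ∈ O, ∀ y ∈ O, J (x * y) = J x * J y := fun x hx y hy => hinj <| by
    rw [← hJ _ (O.mul_mem hx hy), map_mul, Subring.coe_mul, hmul, mul_assoc, hJ y hy, ← mul_assoc,
      hJ x hx, mul_assoc, map_matrix_mul]
  have J_add : ∀ x ∈ O, ∀ y ∈ O, J (x + y) = J x + J y := fun x hx y hy => hinj <| by
    rw [← hJ _ (O.add_mem hx hy), map_add, Subring.coe_add, map_add, add_mul, hJ y hy,
      hJ x hx, Matrix.map_add _ (map_add _), mul_add]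
  have J_alg : ∀ r : Fv⟦X⟧, J (algebraMap Fv⟦X⟧ E r) = constPower Fv R r • 1 := fun r => hinj <| by
    have e : (constPower Fv R r • (1 : Matrix I I R⟦X⟧)).map (algebraMap R⟦X⟧ R⸨X⸩) =
        algebraMap R⟦X⟧ R⸨X⸩ (constPower Fv R r) • 1 := by
      ext1 i j
      by_cases h : i = j <;> simp [h]
    rw [← hJ _ (O.algebraMap_mem r), Algebra.algebraMap_eq_smul_one, coe_smul_qEnd, map_smul,
      map_one, Subring.coe_one, hone, e, Matrix.smul_mul, Matrix.mul_smul, one_mul, mul_one]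
  let j : O →ₐ[Fv⟦X⟧] N.End :=
    { toFun := fun a => ⟨Matrix.toLin c c (J a),
        isMorphism_toLin_of_conjugate hT hT' hB hBT (φ a).2 (hJ a a.2)⟩
      map_one' := Subtype.ext <| by
        change Matrix.toLin c c (J 1) = 1
        rw [J_one, Matrix.toLin_one]
        rfl
      map_mul' := fun x y => Subtype.ext <| by
        change Matrix.toLin c c (J (x * y)) = Matrix.toLin c c (J x) * Matrix.toLin c c (J y)
        rw [J_mul x x.2 y y.2, Matrix.toLin_mul c c c]
        rfl
      map_zero' := Subtype.ext <| by
        change Matrix.toLin c c (J 0) = 0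
        have := J_add 0 O.zero_mem 0 O.zero_mem
        rw [add_zero, left_eq_add] at this
        rw [this, map_zero]
      map_add' := fun x y => Subtype.ext <| by
        change Matrix.toLin c c (J (x + y)) = Matrix.toLin c c (J x) + Matrix.toLin c c (J y)
        rw [J_add x x.2 y y.2, map_add]
      commutes' := fun r => Subtype.ext <| by
        change Matrix.toLin c c (J (algebraMap Fv⟦X⟧ E r)) = algebraMap R⟦X⟧ _ (constPower Fv R r)
        rw [J_alg, map_smul, Matrix.toLin_one, Algebra.algebraMap_eq_smul_one]
        rfl }
  refine ⟨j, fun a => ?_⟩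
  rw [hJ a a.2]
  change _ = B * (LinearMap.toMatrix c c (Matrix.toLin c c (J a))).map _
  rw [LinearMap.toMatrix_toLin]

/-- The conclusion of the main theorem for a local shtuka `N` whose `τ` is conjugate to that of
`M` by the matrix `B`. -/
lemma exists_quasiIsogeny_algHom {M N : LocalShtuka Fv ζ} {b : Module.Basis I R⟦X⟧ M.carrier}
    {c : Module.Basis I R⟦X⟧ N.carrier} {n : ℕ} {T T' : Matrix I I R⟦X⟧}
    (hT : algebraMap R⟦X⟧ (AwayZeta ζ) (PowerSeries.X - PowerSeries.C ζ) ^ n • M.tauMatrix b =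
      T.map (algebraMap R⟦X⟧ (AwayZeta ζ)))
    (hT' : algebraMap R⟦X⟧ (AwayZeta ζ) (PowerSeries.X - PowerSeries.C ζ) ^ n • N.tauMatrix c =
      T'.map (algebraMap R⟦X⟧ (AwayZeta ζ)))
    {B : Matrix I I R⸨X⸩} (hB : IsUnit B.det)
    (hBT : T.map (algebraMap R⟦X⟧ R⸨X⸩) * B.map (laurentMap (frob Fv R)) =
      B * T'.map (algebraMap R⟦X⟧ R⸨X⸩))
    {E : Type*} [CommRing E] [Algebra Fv⸨X⸩ E] [Algebra Fv⟦X⟧ E] [IsScalarTower Fv⟦X⟧ Fv⸨X⸩ E]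
    (φ : E →ₐ[Fv⸨X⸩] M.QEnd) (hφ : Function.Injective φ) (O : Subalgebra Fv⟦X⟧ E)
    (hO : ∀ a ∈ O, ∃ A : Matrix I I R⟦X⟧,
      laurentMatrix b b (φ a : Module.End R⸨X⸩ M.Laurent) * B =
        B * A.map (algebraMap R⟦X⟧ R⸨X⸩)) :
    ∃ (f : QuasiIsogeny M N) (j : O →ₐ[Fv⟦X⟧] N.End), Function.Injective j ∧
      ∀ a : O, LinearMap.baseChange R⸨X⸩ (j a : Module.End R⟦X⟧ N.carrier) ∘ₗ
          (f.toLinearEquiv : M.Laurent →ₗ[R⸨X⸩] N.Laurent) =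
        (f.toLinearEquiv : M.Laurent →ₗ[R⸨X⸩] N.Laurent) ∘ₗ
          (φ (a : E) : Module.End R⸨X⸩ M.Laurent) := by
  obtain ⟨f, hf⟩ := exists_quasiIsogeny hT hT' hB hBT
  obtain ⟨j, hj⟩ := exists_algHom_of_conjugate hT hT' hB hBT φ O hO
  have hBu := (Matrix.isUnit_iff_isUnit_det B).2 hB
  refine ⟨f, j, fun x y hxy => ?_, fun a => ?_⟩
  · have h := hj x
    rw [hxy, ← hj y] at h
    exact Subtype.ext (hφ (Subtype.ext ((laurentMatrix b b).injective (hBu.mul_right_cancel h))))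
  · apply (laurentMatrix b c).injective
    have h1 := LinearMap.toMatrix_comp (Algebra.TensorProduct.basis R⸨X⸩ b)
      (Algebra.TensorProduct.basis R⸨X⸩ c) (Algebra.TensorProduct.basis R⸨X⸩ c)
      (LinearMap.baseChange R⸨X⸩ (j a : Module.End R⟦X⟧ N.carrier))
      (f.toLinearEquiv : M.Laurent →ₗ[R⸨X⸩] N.Laurent)
    have h2 := LinearMap.toMatrix_comp (Algebra.TensorProduct.basis R⸨X⸩ b)
      (Algebra.TensorProduct.basis R⸨X⸩ b) (Algebra.TensorProduct.basis R⸨X⸩ c)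
      (f.toLinearEquiv : M.Laurent →ₗ[R⸨X⸩] N.Laurent) (φ (a : E) : Module.End R⸨X⸩ M.Laurent)
    rw [LinearMap.toMatrix_baseChange] at h1
    refine h1.trans (Eq.trans ?_ h2.symm)
    rw [hf]
    -- Multiplying by `B` on both sides removes the two occurrences of `B⁻¹` and leaves the defining
    -- relation `hj` of `j a`.
    apply hBu.mul_left_cancel
    apply hBu.mul_right_cancel
    rw [← mul_assoc, mul_assoc _ B⁻¹, Matrix.nonsing_inv_mul B hB, mul_one, ← mul_assoc,
      Matrix.mul_nonsing_inv B hB, one_mul, hj a]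

end LocalShtuka

end

/-! ### The main theorem. -/

open LocSht LocalShtuka in
theorem proposition3p2
    {Fv : Type u} [Field Fv] [Fintype Fv]
    {R : Type v} [CommRing R] [IsDomain R] [IsDiscreteValuationRing R]
    [IsAdicComplete (IsLocalRing.maximalIdeal R) R] [Finite (IsLocalRing.ResidueField R)]
    [Algebra Fv R] (γ : Fv⟦X⟧ →ₐ[Fv] R) (hγ : Function.Injective γ)
    (hζ : γ PowerSeries.X ∈ IsLocalRing.maximalIdeal R)
    (M : LocalShtuka.{u, v, w} Fv (γ PowerSeries.X))
    {E : Type*} [CommRing E] [Algebra Fv⸨X⸩ E]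
    [Algebra Fv⟦X⟧ E] [IsScalarTower Fv⟦X⟧ Fv⸨X⸩ E]
    (ι : E →ₐ[Fv⸨X⸩] M.QEnd) (hCM : M.IsCM ι) :
    ∃ (M' : LocalShtuka.{u, v, w} Fv (γ PowerSeries.X)) (f : LocalShtuka.QuasiIsogeny M M')
      (j : integralClosure Fv⟦X⟧ E →ₐ[Fv⟦X⟧] M'.End),
      Function.Injective j ∧
      ∀ a : integralClosure Fv⟦X⟧ E,
        LinearMap.baseChange R⸨X⸩ (j a : Module.End R⟦X⟧ M'.carrier) ∘ₗ (f.toLinearEquiv : M.Laurent →ₗ[R⸨X⸩] M'.Laurent) =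
          (f.toLinearEquiv : M.Laurent →ₗ[R⸨X⸩] M'.Laurent) ∘ₗ
            (ι (a : E) : Module.End R⸨X⸩ M.Laurent) := by
  classical
  have := hCM.isSemisimpleRing
  have := hCM.finite
  let b := Module.Free.chooseBasis R⟦X⟧ M.carrier
  obtain ⟨n, T, hT⟩ := M.exists_pow_smul_tauMatrix b
  obtain ⟨m, hm⟩ := M.exists_X_pow_smul_laurentMatrix_integral b ι
    (Subalgebra.toSubmodule (integralClosure Fv⟦X⟧ E)) fg_integralClosure
  -- Being quasi-endomorphisms, these matrices satisfy the commutation relation with `T`; finiteness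
  -- of the integral closure bounds them all by `X ^ m`.
  let O : Submonoid (Matrix _ _ R⸨X⸩) :=
    { carrier := {A | ∃ a ∈ integralClosure Fv⟦X⟧ E,
        A = laurentMatrix b b (ι a : Module.End R⸨X⸩ M.Laurent)}
      one_mem' := ⟨1, one_mem _, by
        rw [map_one, Subring.coe_one]
        exact (LinearMap.toMatrix_one _).symm⟩
      mul_mem' := by
        rintro _ _ ⟨x, hx, rfl⟩ ⟨y, hy, rfl⟩
        refine ⟨x * y, mul_mem hx hy, ?_⟩
        rw [map_mul, Subring.coe_mul]
        exact (LinearMap.toMatrix_mul _ _ _).symm }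
  obtain ⟨B, T', w, hB, hBT, hdet, hO⟩ := exists_integral_conjugate (frob Fv R)
    (frob_injective Fv R) T O
    (by
      rintro _ ⟨a, -, rfl⟩
      exact (isQuasiMorphism_iff_integral hT hT _).1 (ι a).2)
    m
    (by
      rintro _ ⟨a, ha, rfl⟩
      exact hm a ha)
  -- Up to the unit `w`, `det T'` is `det T`, which is a power of `z - ζ` times the invertible
  -- determinant of `τ`.
  have hTdet : IsUnit (algebraMap R⟦X⟧ (AwayZeta (γ PowerSeries.X)) T'.det) := by
    have h := congrArg Matrix.det hT
    rw [Matrix.det_smul, ← RingHom.mapMatrix_apply, ← RingHom.map_det] at h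
    rw [hdet, map_mul, ← h]
    exact (w.isUnit.map _).mul (((isUnit_algebraMap_awayZeta.pow n).pow _).mul
      (M.isUnit_det_tauMatrix b))
  obtain ⟨M', c, hT'⟩ := M.exists_tauMatrix_eq b n T' hTdet
  obtain ⟨f, j, hj, h⟩ := exists_quasiIsogeny_algHom hT hT' hB hBT ι hCM.injective
    (integralClosure Fv⟦X⟧ E) fun a ha => hO _ ⟨a, ha, rfl⟩
  exact ⟨M', f, j, hj, h⟩
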